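/- Let $L$ be a computable first-order language with a (finite or infinite) list of symbols, and let $(\mathcal A_i)_{i\in\omega}$ be a computable list of computable $L$-structures: the domains $A_i\subseteq\omega$ and the relations and functions of $\mathcal A_i$ are computable, uniformly in $i$ and in the symbol. Function symbols are treated as relation symbols for their graphs, so atomic formulas below are $x=y$, $R(\bar x)$ and $f(\bar x)=y$. For tuples $\bar a\in\mathcal A$, $\bar b\in\mathcal B$ of the same length put $(\mathcal A,\bar a)\le_0(\mathcal B,\bar b)$ if $\bar a$ and $\bar b$ satisfy the same atomic formulas using the first $|\bar a|$ symbols of $L$, and put $(\mathcal A,\bar a)\le_{n+1}(\mathcal B,\bar b)$ if for every finite tuple $\bar b'\in\mathcal B$ there is a tuple $\bar a'\in\mathcal A$ of the same length with $(\mathcal B,\bar b\bar b')\le_n(\mathcal A,\bar a\bar a')$. An infinitary formula is $\Sigma_0=\Pi_0$ if it is finitary quantifier-free; it is $\Sigma_{n+1}$ if it is a countable disjunction $\bigvee_c\exists\bar y_c\,\psi_c$ with each $\psi_c$ a $\Pi_n$ formula, and $\Pi_{n+1}$ if it is a countable conjunction $\bigwedge_c\forall\bar y_c\,\psi_c$ with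 each $\psi_c$ a $\Sigma_n$ formula. For $X\subseteq\omega$, an index of an $X$-computable $\Sigma_0=\Pi_0$ formula is its Gödel number; $e$ is an index of the $X$-computable $\Sigma_{n+1}$ (respectively $\Pi_{n+1}$) formula whose family of disjuncts (conjuncts) is given by the set $W_e^X$, c.e. relative to $X$, of pairs consisting of the length of $\bar y_c$ and an index of $\psi_c$ as an $X$-computable $\Pi_n$ (respectively $\Sigma_n$) formula. Theorem. For every $n$, $i$ and every finite tuple $\bar a\in\mathcal A_i$ there is a $\mathbf 0^{(n)}$-computable $\Pi_n$ formula $\varphi^n_{i,\bar a}(\bar x)$, $|\bar x|=|\bar a|$, such that for all $j$ and all $\bar b\in\mathcal A_j$ with $|\bar b|=|\bar a|$, \[ (\mathcal A_i,\bar a)\le_n(\mathcal A_j,\bar b)\iff \mathcal A_j\models\varphi^n_{i,\bar a}(\bar b). \] Moreover this is uniform in $n$, $i$ and $\bar a$: there is a single (total) computable function which maps each triple $(n,i,\bar a)$ with $\bar a\in\mathcal A_i$ to an index of $\varphi^n_{i,\bar a}$ as a $\mathbf 0^{(n)}$-computable $\Pi_n$ formula. -/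

import Mathlib

open FirstOrder FirstOrder.Language

/-! ### Computability relative to an oracle -/

/-- `σ` is an initial segment of the characteristic function of `X`. -/
def IsInitialSegment (X : Set ℕ) (σ : List Bool) : Prop :=
  ∀ m b, σ[m]? = some b → (b = true ↔ m ∈ X)

/-- `W_e^X`, the `e`-th set that is computably enumerable relative to `X`: `x` is enumerated when
the `e`-th program halts on `x` together with some finite initial segment of the oracle. -/
def oracleW (X : Set ℕ) (e : ℕ) : Set ℕ :=
  {x | ∃ σ : List Bool, IsInitialSegment X σ ∧
    ((Denumerable.ofNat Nat.Partrec.Code e).eval (Nat.pair x (Encodable.encode σ))).Dom}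

/-- The Turing jump `X' = {e | e ∈ W_e^X}`. -/
def turingJump (X : Set ℕ) : Set ℕ := {e | e ∈ oracleW X e}

/-- `0^(n)`, the `n`-th Turing jump of the empty set. -/
def zeroJump (n : ℕ) : Set ℕ := turingJump^[n] ∅

/-! ### Computable languages and computable lists of computable structures -/

/-- A computable first-order language, with a finite or infinite list of symbols: `sym r` is
`some (inl m)` if the `r`-th symbol is an `m`-ary relation symbol, `some (inr m)` if it is an
`m`-ary function symbol (a constant symbol when `m = 0`), and `none` if there is no `r`-th symbol,
in which case the list has ended. -/
structure ComputableSignature where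
  sym : ℕ → Option (ℕ ⊕ ℕ)
  computable_sym : Computable sym
  ended : ∀ r, sym r = none → sym (r + 1) = none

/-- The underlying first-order language. -/
def ComputableSignature.lang (S : ComputableSignature) : FirstOrder.Language.{0, 0} where
  Functions m := {r : ℕ // S.sym r = some (Sum.inr m)}
  Relations m := {r : ℕ // S.sym r = some (Sum.inl m)}

/-- The structures on the sets `dom i ⊆ ℕ` form a computable list of computable structures:
the domains are uniformly computable, and so are the relations and (the graphs of) the functions,
uniformly also in the symbol. -/
def IsComputableList (S : ComputableSignature) (dom : ℕ → Set ℕ)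
    [∀ i, S.lang.Structure (dom i)] : Prop :=
  ComputablePred (fun p : ℕ × ℕ => p.2 ∈ dom p.1) ∧
  ComputablePred (fun p : ℕ × ℕ × List ℕ =>
    ∃ (m : ℕ) (R : S.lang.Relations m) (t : Fin m → dom p.1),
      R.1 = p.2.1 ∧ List.ofFn (fun x => (t x : ℕ)) = p.2.2 ∧ Structure.RelMap R t) ∧
  ComputablePred (fun p : ℕ × ℕ × List ℕ × ℕ =>
    ∃ (m : ℕ) (F : S.lang.Functions m) (t : Fin m → dom p.1),
      F.1 = p.2.1 ∧ List.ofFn (fun x => (t x : ℕ)) = p.2.2.1 ∧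
        ((Structure.funMap F t : dom p.1) : ℕ) = p.2.2.2)

/-! ### Back-and-forth relations -/

/-- The tuples `a` and `b` of length `k` satisfy the same atomic (equivalently, the same atomic and
negated atomic) formulas using the first `k` symbols of the language. A function symbol is treated
as a relation symbol for its graph, that is, it occurs only in the form `f(x₁, …, x_m) = y`. -/
def SameAtomic (S : ComputableSignature) (M N : Type) [S.lang.Structure M] [S.lang.Structure N]
    {k : ℕ} (a : Fin k → M) (b : Fin k → N) : Prop :=
  (∀ x y : Fin k, a x = a y ↔ b x = b y) ∧
  (∀ (m : ℕ) (R : S.lang.Relations m), R.1 < k → ∀ t : Fin m → Fin k,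
    (Structure.RelMap R (fun x => a (t x)) ↔ Structure.RelMap R (fun x => b (t x)))) ∧
  (∀ (m : ℕ) (F : S.lang.Functions m), F.1 < k → ∀ (t : Fin m → Fin k) (y : Fin k),
    (Structure.funMap F (fun x => a (t x)) = a y ↔ Structure.funMap F (fun x => b (t x)) = b y))

/-- The standard asymmetric back-and-forth relation `(M, a) ≤_n (N, b)`. -/
def BackForth (S : ComputableSignature) : (n : ℕ) → (M N : Type) →
    [S.lang.Structure M] → [S.lang.Structure N] → {k : ℕ} → (Fin k → M) → (Fin k → N) → Prop
  | 0, M, N, _, _, _, a, b => SameAtomic S M N a b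
  | n + 1, M, N, _, _, _, a, b => ∀ (m : ℕ) (b' : Fin m → N), ∃ a' : Fin m → M,
      BackForth S n N M (Fin.append b b') (Fin.append a a')

/-! ### Infinitary formulas -/

inductive Side
  | sigma
  | pi

def Side.dual : Side → Side
  | .sigma => .pi
  | .pi => .sigma

/-- `InfFormula L .sigma n k` and `InfFormula L .pi n k` are the infinitary `Σ_n` and `Π_n`
formulas of `L` in the free variables `x_0, …, x_{k-1}`. At level `0` these are the finitary
quantifier-free formulas. A formula at level `n + 1` is given by a countable family of formulas
`ψ_c` of the dual side at level `n`, where `ψ_c` has `m c` further free variables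
`x_k, …, x_{k + m c - 1}`. It stands for `⋁_c ∃ x_k … ψ_c` on the side `Σ` and for
`⋀_c ∀ x_k … ψ_c` on the side `Π`. -/
inductive InfFormula (L : FirstOrder.Language.{0, 0}) : Side → ℕ → ℕ → Type
  | qf {s : Side} {k : ℕ} (ψ : L.Formula (Fin k)) (hψ : BoundedFormula.IsQF ψ) : InfFormula L s 0 k
  | node {s : Side} {n k : ℕ} (C : Set ℕ) (m : C → ℕ)
      (ψ : (c : C) → InfFormula L s.dual n (k + m c)) : InfFormula L s (n + 1) k

/-- Satisfaction of an infinitary formula by a tuple `v` in the structure `M`. -/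
def InfFormula.Realize {L : FirstOrder.Language.{0, 0}} (M : Type) [L.Structure M] :
    {s : Side} → {n k : ℕ} → InfFormula L s n k → (Fin k → M) → Prop
  | _, _, _, .qf ψ _, v => Formula.Realize ψ v
  | .sigma, _, _, .node C m ψ, v =>
      ∃ (c : C) (y : Fin (m c) → M), (ψ c).Realize M (Fin.append v y)
  | .pi, _, _, .node C m ψ, v =>
      ∀ (c : C) (y : Fin (m c) → M), (ψ c).Realize M (Fin.append v y)

/-! ### Indices of infinitary formulas relative to an oracle -/

/-- Gödel number of a term. -/
def termCode (S : ComputableSignature) {k n : ℕ} : S.lang.Term (Fin k ⊕ Fin n) → ℕ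
  | .var (Sum.inl x) => 3 * x
  | .var (Sum.inr x) => 3 * x + 1
  | .func F ts =>
      3 * Nat.pair F.1 (Encodable.encode (List.ofFn fun x => termCode S (ts x))) + 2

/-- Gödel number of a finitary formula. -/
def formulaCode (S : ComputableSignature) {k : ℕ} :
    {n : ℕ} → S.lang.BoundedFormula (Fin k) n → ℕ
  | _, .falsum => 0
  | _, .equal t u => 5 * Nat.pair (termCode S t) (termCode S u) + 1
  | _, .rel R ts =>
      5 * Nat.pair R.1 (Encodable.encode (List.ofFn fun x => termCode S (ts x))) + 2
  | _, .imp φ ψ => 5 * Nat.pair (formulaCode S φ) (formulaCode S ψ) + 3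
  | _, .all φ => 5 * formulaCode S φ + 4

/-- `e` is an index for `φ` as an `X`-computable infinitary formula: at level `0` it is the Gödel
number of the finitary formula; at level `n + 1` the family of immediate subformulas is given by
the set `W_e^X` of pairs `⟨m, e'⟩`, where `m` is the number of newly quantified variables and `e'`
is an index for the corresponding `X`-computable subformula at level `n`. -/
def IsIndex (S : ComputableSignature) (X : Set ℕ) :
    {s : Side} → {n k : ℕ} → InfFormula S.lang s n k → ℕ → Prop
  | _, _, _, .qf ψ _, e => formulaCode S ψ = e
  | _, _, _, .node C m ψ, e =>
      C = oracleW X e ∧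
        ∀ c : C, m c = (Nat.unpair c).1 ∧ IsIndex S X (ψ c) (Nat.unpair c).2

/-! ### Computable predicates, list operations and the recursion theorem for oracle enumerations -/

section Computability

open Encodable Nat.Partrec

variable {α β γ : Type*} [Primcodable α] [Primcodable β] [Primcodable γ]

/-! Let P, P', Q be tuples in structures of the list. Then P ≤_{n+1} Q iff, for every m and every P'
of length |P| + m that is n-below no extension Pc, no y has P' ≤_n Qy. One direction is transitivity
of ≤_n; for the other take P' = Qy, which itself lives on the list, and use reflexivity. So "P
≤_{n+1} Q" is a conjunction of formulas ∀y ¬φ_{P'}(y), which has the shape Π_{n+1}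
(`stateHolds_succ_iff`).

The difficulty is the oracle. "P' is n-below an extension of P" is a Σ_{2n+1} question of
arithmetic, in general too hard for 0^(n+1). Its negation is therefore not tested when P' is
enumerated but becomes a variable-free conjunct of the subformula for P'. The question is presented
as a game of level 2n (`extensionWon_two_mul`), and each level of the formula strips one alternation
from it by an infinite conjunction or disjunction without new variables. A state records both
halves: a tuple to be compared and a game position not to be won.

With N the fixed number of jumps in the oracle, a position of level p inside a subformula of level n
satisfies n ≤ p and p + 1 ≤ N + n (`IsChild.stateValid`). Hence at the leaves p + 1 ≤ N, so 0^(N)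
decides the rest (`exists_gameWon_index`) and only leaves whose condition is true are enumerated;
what remains there is a finite atomic diagram. The recursion theorem
(`exists_selfReferential_index`) makes the enumerations refer to their own indices, uniformly in all
parameters, and `IsStateIndexing.realize_iff` shows that the indexed formulas mean what the states
say. -/

theorem ComputablePred.comp {p : β → Prop} (hp : ComputablePred p) {f : α → β}
    (hf : Computable f) : ComputablePred fun a => p (f a) := by
  classical exact Computable.computablePred (hp.decide.comp hf)

theorem ComputablePred.and {p q : α → Prop} (hp : ComputablePred p) (hq : ComputablePred q) :
    ComputablePred fun a => p a ∧ q a := by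
  classical
  refine Computable.computablePred ((Primrec.and.to_comp.comp hp.decide hq.decide).of_eq ?_)
  simp

theorem ComputablePred.or {p q : α → Prop} (hp : ComputablePred p) (hq : ComputablePred q) :
    ComputablePred fun a => p a ∨ q a := by
  classical
  refine Computable.computablePred ((Primrec.or.to_comp.comp hp.decide hq.decide).of_eq ?_)
  simp

theorem Computable.eq_pred {f g : α → β} (hf : Computable f) (hg : Computable g) :
    ComputablePred fun a => f a = g a := by
  classical
  have h : ComputablePred fun p : β × β => p.1 = p.2 := PrimrecPred.computablePred Primrec.eq
  exact h.comp (hf.pair hg)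

/-- Recursion on the length of a prefix: stage n holds the image of the first n entries. -/
theorem Computable.list_map {f : α → List β} {g : α → β → γ} (hf : Computable f)
    (hg : Computable₂ g) : Computable fun a => (f a).map (g a) := by
  have hstep : Computable₂ fun (a : α) (p : ℕ × List γ) =>
      ((f a)[p.1]?).elim p.2 fun b => p.2 ++ [g a b] := by
    have hopt : Computable fun q : α × ℕ × List γ => (f q.1)[q.2.1]? :=
      Computable.list_getElem?.comp (hf.comp Computable.fst)
        (Computable.fst.comp Computable.snd)
    have hsome : Computable₂ fun (q : α × ℕ × List γ) (b : β) => q.2.2 ++ [g q.1 b] :=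
      Computable.list_concat.comp
        ((Computable.snd.comp Computable.snd).comp Computable.fst)
        (hg.comp (Computable.fst.comp Computable.fst) Computable.snd)
    refine (Computable.option_casesOn hopt (Computable.snd.comp Computable.snd) hsome).of_eq ?_
    rintro ⟨a, n, l⟩
    dsimp only
    cases (f a)[n]? <;> rfl
  refine (Computable.nat_rec (Computable.list_length.comp hf) (Computable.const []) hstep).of_eq ?_
  intro a
  have key : ∀ n, n ≤ (f a).length →
      (Nat.rec (motive := fun _ => List γ) []
        (fun n l => ((f a)[n]?).elim l fun b => l ++ [g a b]) n) = ((f a).take n).map (g a) := by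
    intro n
    induction n with
    | zero => intro _; simp
    | succ n ih =>
      intro hn
      have hlt : n < (f a).length := hn
      simp only [ih hlt.le]
      rw [List.take_add_one, List.getElem?_eq_getElem hlt, List.map_append]
      simp
  simpa using key _ le_rfl

/-- The predicate "every entry of the list satisfies `p`" is computable when `p` is. -/
theorem ComputablePred.forall_mem_list {p : α → β → Prop}
    (hp : ComputablePred fun q : α × β => p q.1 q.2) {f : α → List β} (hf : Computable f) :
    ComputablePred fun a => ∀ b ∈ f a, p a b := by
  classical
  have hm : Computable fun a => (f a).map fun b => decide (p a b) :=
    Computable.list_map hf hp.decide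
  have hall : PrimrecPred fun l : List Bool => ∀ b ∈ l, b = true :=
    PrimrecPred.forall_mem_list (Primrec.eq.comp Primrec.id (Primrec.const true))
  exact (hall.computablePred.comp hm).of_eq fun a => by simp

/-- The index obtained by fixing the first argument of the program `c`. -/
def sectionIndex (c : Code) (a : α) : ℕ := encode (Code.curry c (encode a))

theorem computable_sectionIndex : Computable₂ (sectionIndex : Code → α → ℕ) :=
  Computable.encode.comp
    (Code.primrec₂_curry.to_comp.comp Computable.fst (Computable.encode.comp Computable.snd))

/-- A uniformly c.e. family of oracle-c.e. operators may refer to its own indices. -/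
theorem exists_selfReferential_index {K : Code × (α × ℕ × List Bool) × β → Prop}
    (hK : ComputablePred K) :
    ∃ c : Code, ∀ (X : Set ℕ) (a : α) (x : ℕ), x ∈ oracleW X (sectionIndex c a) ↔
      ∃ σ, IsInitialSegment X σ ∧ ∃ w, K (c, (a, x, σ), w) := by
  classical
  -- Pairing the input with the candidate `w` gives the code of (input, witness). A candidate that
  -- decodes to nothing counts as `false`, so the unbounded search skips it.
  let k : Code × ℕ → ℕ → Bool := fun p w =>
    ((decode (α := (α × ℕ × List Bool) × β) (Nat.pair p.2 w)).map
      fun q => decide (K (p.1, q))).getD false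
  have hk : Computable₂ k := by
    refine Computable.option_getD (Computable.option_map (Computable.decode.comp ?_) ?_)
      (Computable.const false)
    · exact Primrec₂.natPair.to_comp.comp (Computable.snd.comp Computable.fst) Computable.snd
    · exact hK.decide.comp
        (((Computable.fst.comp Computable.fst).comp Computable.fst).pair Computable.snd)
  -- The second recursion theorem: `c` searches for a witness to `K` with its own code as first
  -- argument.
  obtain ⟨c, hc⟩ := Code.fixed_point₂ (f := fun c n => Nat.rfind fun w => Part.some (k (c, n) w))
    (Partrec.rfind hk.partrec₂)
  refine ⟨c, fun X a x => ?_⟩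
  simp only [oracleW, sectionIndex, Set.mem_ofPred_eq, Denumerable.ofNat_encode, Code.eval_curry, hc]
  refine exists_congr fun σ => and_congr_right fun _ => ?_
  refine Iff.trans Nat.rfind_dom ?_
  simp only [Part.mem_some_iff, Part.some_dom, implies_true, and_true]
  have henc : Nat.pair (encode a) (Nat.pair x (encode σ)) = encode (a, x, σ) := rfl
  rw [henc]
  have hkw : ∀ w, k (c, encode (a, x, σ)) w =
      ((decode (α := β) w).map fun b => decide (K (c, (a, x, σ), b))).getD false := by
    intro w
    simp [k, Function.comp_def]
  simp only [hkw]
  constructor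
  · rintro ⟨w, hw⟩
    cases h : decode (α := β) w with
    | none => simp [h] at hw
    | some b => exact ⟨b, by simpa [h] using hw⟩
  · rintro ⟨b, hb⟩
    exact ⟨encode b, by simp [hb]⟩

end Computability

/-! ### Turing jumps and the complexity of computable games -/

section Jump

open Encodable Nat.Partrec

variable {α β : Type*} [Primcodable α] [Primcodable β]

theorem zeroJump_succ (n : ℕ) : zeroJump (n + 1) = turingJump (zeroJump n) :=
  Function.iterate_succ_apply' _ _ _

/-- Any answer of the oracle, positive or negative, is visible in a finite initial segment; this is
how oracle queries enter enumerations. -/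
theorem exists_isInitialSegment (X : Set ℕ) (m : ℕ) (b : Bool) :
    (∃ σ, IsInitialSegment X σ ∧ σ[m]? = some b) ↔ (b = true ↔ m ∈ X) := by
  classical
  constructor
  · rintro ⟨σ, hσ, h⟩
    exact hσ m b h
  · intro h
    refine ⟨(List.range (m + 1)).map fun x => decide (x ∈ X), ?_, ?_⟩
    · intro x b hx
      rw [List.getElem?_map, Option.map_eq_some_iff] at hx
      obtain ⟨y, hy, rfl⟩ := hx
      rw [List.getElem?_eq_some_iff] at hy
      obtain ⟨_, rfl⟩ := hy
      simp
    · rw [List.getElem?_map, List.getElem?_range (Nat.lt_succ_self m)]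
      cases b <;> simp_all

/-- The set indexed by `u y` is everything or empty, according to whether the oracle contains y, so
self-membership of the index answers "y ∈ X". The function does not depend on X. -/
theorem exists_jump_embedding :
    ∃ u : ℕ → ℕ, Computable u ∧ ∀ X y, u y ∈ turingJump X ↔ y ∈ X := by
  have hK : ComputablePred fun q : Code × (ℕ × ℕ × List Bool) × Unit =>
      q.2.1.2.2[q.2.1.1]? = some true :=
    Computable.eq_pred
      (Computable.list_getElem?.comp
        (Computable.snd.comp (Computable.snd.comp (Computable.fst.comp Computable.snd)))
        (Computable.fst.comp (Computable.fst.comp Computable.snd)))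
      (Computable.const _)
  obtain ⟨c, hc⟩ := exists_selfReferential_index hK
  refine ⟨sectionIndex c, computable_sectionIndex.comp (Computable.const c) Computable.id, ?_⟩
  intro X y
  rw [turingJump, Set.mem_ofPred_eq, hc]
  simpa using exists_isInitialSegment X y true

/-- Computable reduction of the lower jumps to the higher ones. -/
theorem exists_iterated_jump_embedding :
    ∃ u : ℕ × ℕ → ℕ, Computable u ∧ ∀ d m y, u (d, y) ∈ zeroJump (m + d) ↔ y ∈ zeroJump m := by
  obtain ⟨u, hu, h⟩ := exists_jump_embedding
  refine ⟨fun p => Nat.rec (motive := fun _ => ℕ) p.2 (fun _ z => u z) p.1,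
    Computable.nat_rec Computable.fst Computable.snd
      (hu.comp (Computable.snd.comp Computable.snd)).to₂, fun d m y => ?_⟩
  induction d with
  | zero => rfl
  | succ d ih =>
    rw [← add_assoc, zeroJump_succ, ← ih]
    exact h _ _

/-- The arithmetical hierarchy generated by a computable game: `base` is searched for at level
`0`, and a level `p + 1` position is won by a valid move to a position which is not won at
level `p`. -/
def gameWon (base : α × β → Prop) (valid : ℕ × α × β → Prop) (next : ℕ × α × β → α) :
    ℕ → α → Prop
  | 0, x => ∃ z, base (x, z)
  | p + 1, x => ∃ z, valid (p, x, z) ∧ ¬ gameWon base valid next p (next (p, x, z))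

/-- Winning at level p is Σ_{p+1}: each level adds one existential quantifier in front of a
negation, hence costs one jump. -/
theorem exists_gameWon_index {base : α × β → Prop} {valid : ℕ × α × β → Prop}
    {next : ℕ × α × β → α} (hbase : ComputablePred base) (hvalid : ComputablePred valid)
    (hnext : Computable next) :
    ∃ t : ℕ × α → ℕ, Computable t ∧
      ∀ p x, gameWon base valid next p x ↔ t (p, x) ∈ zeroJump (p + 1) := by
  -- `K` ignores the number to be enumerated, so each indexed set is everything or empty and
  -- membership of the index in the jump says that the search succeeds. At a successor level the
  -- search looks for a valid move whose next position has, by the same program, an index absent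
  -- from the oracle.
  let K : Code × ((ℕ × α) × ℕ × List Bool) × ℕ × β → Prop := fun q =>
    (q.2.1.1.1 = 0 ∧ base (q.2.1.1.2, q.2.2.2)) ∨
    (q.2.1.1.1 = q.2.2.1 + 1 ∧ valid (q.2.2.1, q.2.1.1.2, q.2.2.2) ∧
      q.2.1.2.2[sectionIndex q.1 (q.2.2.1, next (q.2.2.1, q.2.1.1.2, q.2.2.2))]? = some false)
  have hK : ComputablePred K := by
    have hp : Computable fun q : Code × ((ℕ × α) × ℕ × List Bool) × ℕ × β => q.2.1.1.1 :=
      Computable.fst.comp (Computable.fst.comp (Computable.fst.comp Computable.snd))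
    have hx : Computable fun q : Code × ((ℕ × α) × ℕ × List Bool) × ℕ × β => q.2.1.1.2 :=
      Computable.snd.comp (Computable.fst.comp (Computable.fst.comp Computable.snd))
    have hσ : Computable fun q : Code × ((ℕ × α) × ℕ × List Bool) × ℕ × β => q.2.1.2.2 :=
      Computable.snd.comp (Computable.snd.comp (Computable.fst.comp Computable.snd))
    have hp' : Computable fun q : Code × ((ℕ × α) × ℕ × List Bool) × ℕ × β => q.2.2.1 :=
      Computable.fst.comp (Computable.snd.comp Computable.snd)
    have hz : Computable fun q : Code × ((ℕ × α) × ℕ × List Bool) × ℕ × β => q.2.2.2 :=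
      Computable.snd.comp (Computable.snd.comp Computable.snd)
    have hmove := hp'.pair (hx.pair hz)
    exact ((hp.eq_pred (Computable.const 0)).and (hbase.comp (hx.pair hz))).or
      ((hp.eq_pred (Computable.succ.comp hp')).and
        ((hvalid.comp hmove).and
          (Computable.eq_pred
            (Computable.list_getElem?.comp hσ
              (computable_sectionIndex.comp Computable.fst (hp'.pair (hnext.comp hmove))))
            (Computable.const _))))
  obtain ⟨c, hc⟩ := exists_selfReferential_index hK
  refine ⟨sectionIndex c, computable_sectionIndex.comp (Computable.const c) Computable.id, ?_⟩
  intro p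
  induction p with
  | zero =>
    intro x
    rw [zeroJump_succ, turingJump, Set.mem_ofPred_eq, hc]
    simp only [K, gameWon]
    constructor
    · rintro ⟨z, hz⟩
      -- Level 0 asks nothing of the oracle, so the empty initial segment suffices.
      exact ⟨[], fun m b h => by simp at h, (0, z), Or.inl ⟨trivial, hz⟩⟩
    · rintro ⟨σ, _, w, ⟨_, hz⟩ | ⟨h, _⟩⟩
      · exact ⟨_, hz⟩
      · simp at h
  | succ p ih =>
    intro x
    rw [zeroJump_succ, turingJump, Set.mem_ofPred_eq, hc]
    simp only [K, gameWon]
    constructor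
    · rintro ⟨z, hz, hw⟩
      rw [ih] at hw
      obtain ⟨σ, hσ, h⟩ := (exists_isInitialSegment (zeroJump (p + 1)) _ false).2
        (by simpa using hw)
      exact ⟨σ, hσ, (p, z), Or.inr ⟨rfl, hz, h⟩⟩
    · rintro ⟨σ, hσ, ⟨p', z⟩, ⟨h, _⟩ | ⟨h, hz, hw⟩⟩
      · simp at h
      · obtain rfl : p = p' := by simpa using h
        refine ⟨z, hz, ?_⟩
        rw [ih]
        simpa using hσ _ _ hw

end Jump

/-! ### Injectivity of the Gödel numbering -/

section GodelNumbering

variable (S : ComputableSignature)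

theorem termCode_injective {k n : ℕ} (t u : S.lang.Term (Fin k ⊕ Fin n))
    (h : termCode S t = termCode S u) : t = u := by
  induction t generalizing u with
  | var x =>
    rcases x with x | x <;> rcases u with (y | y) | ⟨G, us⟩ <;> simp only [termCode] at h
    · obtain rfl : x = y := Fin.ext (by omega)
      rfl
    all_goals first
      | omega
      | (obtain rfl : x = y := Fin.ext (by omega)
         rfl)
  | @func l F ts ih =>
    rcases u with (y | y) | @⟨l', G, us⟩ <;> simp only [termCode] at h
    · omega
    · omega
    · have hp : Nat.pair F.1 (Encodable.encode (List.ofFn fun x => termCode S (ts x))) =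
          Nat.pair G.1 (Encodable.encode (List.ofFn fun x => termCode S (us x))) := by omega
      obtain ⟨hF, hl⟩ := Nat.pair_eq_pair.1 hp
      have hl' := Encodable.encode_injective hl
      have hlen : l = l' := by simpa using congrArg List.length hl'
      subst hlen
      obtain rfl : F = G := Subtype.ext hF
      congr 1
      funext x
      exact ih x _ (congrFun (List.ofFn_injective hl') x)

/-- Residues modulo 5 separate the constructors, and the encoded argument list recovers the arity.
An index at level 0 therefore determines its formula. -/
theorem formulaCode_injective {k n : ℕ} (φ ψ : S.lang.BoundedFormula (Fin k) n)
    (h : formulaCode S φ = formulaCode S ψ) : φ = ψ := by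
  induction φ with
  | falsum => cases ψ <;> simp only [formulaCode] at h <;> first | rfl | omega
  | equal t u =>
    cases ψ <;> simp only [formulaCode] at h <;> try omega
    rename_i t' u'
    obtain ⟨h₁, h₂⟩ := Nat.pair_eq_pair.1
      (Nat.eq_of_mul_eq_mul_left (by norm_num : 0 < 5) (Nat.add_right_cancel h))
    rw [termCode_injective S _ _ h₁, termCode_injective S _ _ h₂]
  | @rel n l R ts =>
    cases ψ <;> simp only [formulaCode] at h <;> try omega
    rename_i l' R' ts'
    obtain ⟨h₁, h₂⟩ := Nat.pair_eq_pair.1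
      (Nat.eq_of_mul_eq_mul_left (by norm_num : 0 < 5) (Nat.add_right_cancel h))
    have hl' := Encodable.encode_injective h₂
    have hlen : l = l' := by simpa using congrArg List.length hl'
    subst hlen
    obtain rfl : R = R' := Subtype.ext h₁
    congr 1
    funext x
    exact termCode_injective S _ _ (congrFun (List.ofFn_injective hl') x)
  | imp φ₁ φ₂ ih₁ ih₂ =>
    cases ψ <;> simp only [formulaCode] at h <;> try omega
    obtain ⟨h₁, h₂⟩ := Nat.pair_eq_pair.1
      (Nat.eq_of_mul_eq_mul_left (by norm_num : 0 < 5) (Nat.add_right_cancel h))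
    rw [ih₁ _ h₁, ih₂ _ h₂]
  | all φ ih =>
    cases ψ <;> simp only [formulaCode] at h <;> try omega
    rw [ih _ (Nat.eq_of_mul_eq_mul_left (by norm_num : 0 < 5) (Nat.add_right_cancel h))]

end GodelNumbering

/-! ### Finite lists of atomic formulas -/

section AtomLists

/-- All tuples of length `m` of numbers below `k`. -/
def tuplesBelow (k m : ℕ) : List (List ℕ) :=
  Nat.rec (motive := fun _ => List (List ℕ)) [ [] ]
    (fun _ L => (List.range k).flatMap fun x => L.map fun t => x :: t) m

theorem mem_tuplesBelow {k m : ℕ} {t : List ℕ} :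
    t ∈ tuplesBelow k m ↔ t.length = m ∧ ∀ x ∈ t, x < k := by
  induction m generalizing t with
  | zero => simp +contextual [tuplesBelow]
  | succ m ih =>
    have : tuplesBelow k (m + 1) =
      (List.range k).flatMap fun x => (tuplesBelow k m).map fun t => x :: t := rfl
    rw [this]
    simp only [List.mem_flatMap, List.mem_range, List.mem_map, ih]
    constructor
    · rintro ⟨x, hx, t, ⟨rfl, ht⟩, rfl⟩
      simpa [hx] using ht
    · rintro ⟨hl, ht⟩
      cases t with
      | nil => simp at hl
      | cons x t =>
        exact ⟨x, ht x (by simp), t, ⟨by simpa using hl, fun y hy => ht y (by simp [hy])⟩, rfl⟩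

theorem Computable.list_flatMap {α β γ : Type*} [Primcodable α] [Primcodable β] [Primcodable γ]
    {f : α → List β} {g : α → β → List γ} (hf : Computable f) (hg : Computable₂ g) :
    Computable fun a => (f a).flatMap (g a) :=
  (Primrec.list_flatten.to_comp.comp (Computable.list_map hf hg)).of_eq fun a => by
    simp [List.flatMap]

theorem computable_tuplesBelow : Computable₂ tuplesBelow := by
  have hstep : Computable₂ fun (p : ℕ × ℕ) (q : ℕ × List (List ℕ)) =>
      (List.range p.1).flatMap fun x => q.2.map fun t => x :: t := by
    refine Computable.list_flatMap
      (Primrec.list_range.to_comp.comp (Computable.fst.comp Computable.fst)) ?_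
    refine Computable.list_map
      (Computable.snd.comp (Computable.snd.comp Computable.fst)) ?_
    exact Computable.list_cons.comp (Computable.snd.comp Computable.fst) Computable.snd
  exact Computable.nat_rec Computable.snd (Computable.const ([ [] ] : List (List ℕ))) hstep

/-- Atomic formulas `x = y`, `R(t)` and `F(t) = y`; variables and symbols are given by numbers. -/
abbrev Atom : Type := (ℕ × ℕ) ⊕ (ℕ × List ℕ) ⊕ (ℕ × List ℕ × ℕ)

/-- The atomic formulas in `k` variables using the `r`-th symbol. -/
def symbolAtoms (S : ComputableSignature) (k r : ℕ) : List Atom :=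
  Option.elim (S.sym r) [] fun s =>
    Sum.elim
      (fun m => (tuplesBelow k m).map fun t => Sum.inr (Sum.inl (r, t)))
      (fun m => (tuplesBelow k m).flatMap fun t =>
        (List.range k).map fun y => Sum.inr (Sum.inr (r, t, y))) s

/-- The atomic formulas in `k` variables using the first `k` symbols. -/
def atomList (S : ComputableSignature) (k : ℕ) : List Atom :=
  ((List.range k).flatMap fun x => (List.range k).map fun y => Sum.inl (x, y)) ++
    (List.range k).flatMap fun r => symbolAtoms S k r

theorem computable_symbolAtoms (S : ComputableSignature) : Computable₂ (symbolAtoms S) := by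
  have hk : Computable fun q : (ℕ × ℕ) × (ℕ ⊕ ℕ) => q.1.1 :=
    Computable.fst.comp Computable.fst
  have hrel : Computable₂ fun (q : (ℕ × ℕ) × (ℕ ⊕ ℕ)) (m : ℕ) =>
      (tuplesBelow q.1.1 m).map fun t => (Sum.inr (Sum.inl (q.1.2, t)) : Atom) := by
    refine Computable.list_map
      (computable_tuplesBelow.comp (hk.comp Computable.fst) Computable.snd) ?_
    have hr : Computable fun u : (((ℕ × ℕ) × (ℕ ⊕ ℕ)) × ℕ) × List ℕ => u.1.1.1.2 :=
      Computable.snd.comp (Computable.fst.comp (Computable.fst.comp Computable.fst))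
    exact (Computable.sumInr.comp (Computable.sumInl.comp (hr.pair Computable.snd))).to₂
  have hfun : Computable₂ fun (q : (ℕ × ℕ) × (ℕ ⊕ ℕ)) (m : ℕ) =>
      (tuplesBelow q.1.1 m).flatMap fun t =>
        (List.range q.1.1).map fun y => (Sum.inr (Sum.inr (q.1.2, t, y)) : Atom) := by
    refine Computable.list_flatMap
      (computable_tuplesBelow.comp (hk.comp Computable.fst) Computable.snd) ?_
    refine Computable.list_map (Primrec.list_range.to_comp.comp
      (hk.comp (Computable.fst.comp Computable.fst))) ?_
    have hr : Computable fun u : ((((ℕ × ℕ) × (ℕ ⊕ ℕ)) × ℕ) × List ℕ) × ℕ => u.1.1.1.1.2 :=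
      Computable.snd.comp (Computable.fst.comp
        (Computable.fst.comp (Computable.fst.comp Computable.fst)))
    exact (Computable.sumInr.comp (Computable.sumInr.comp
      (hr.pair ((Computable.snd.comp Computable.fst).pair Computable.snd)))).to₂
  have hs : Computable₂ fun (p : ℕ × ℕ) (s : ℕ ⊕ ℕ) =>
      Sum.elim
        (fun m => (tuplesBelow p.1 m).map fun t => (Sum.inr (Sum.inl (p.2, t)) : Atom))
        (fun m => (tuplesBelow p.1 m).flatMap fun t =>
          (List.range p.1).map fun y => (Sum.inr (Sum.inr (p.2, t, y)) : Atom)) s :=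
    (Computable.sumCasesOn Computable.snd hrel hfun).of_eq fun q => by
      rcases q with ⟨p, m | m⟩ <;> rfl
  exact (Computable.option_casesOn (S.computable_sym.comp Computable.snd)
    (Computable.const []) hs).of_eq fun p => by
      rcases p with ⟨k, r⟩
      dsimp only [symbolAtoms]
      cases S.sym r <;> rfl

theorem computable_atomList (S : ComputableSignature) : Computable (atomList S) := by
  refine Computable.list_append.comp
    (Computable.list_flatMap Primrec.list_range.to_comp ?_)
    (Computable.list_flatMap Primrec.list_range.to_comp (computable_symbolAtoms S))
  refine Computable.list_map (Primrec.list_range.to_comp.comp Computable.fst) ?_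
  exact Computable.sumInl.comp ((Computable.snd.comp Computable.fst).pair Computable.snd)

theorem eq_mem_atomList {S : ComputableSignature} {k x y : ℕ} :
    Sum.inl (x, y) ∈ atomList S k ↔ x < k ∧ y < k := by
  have : ∀ r, (Sum.inl (x, y) : Atom) ∉ symbolAtoms S k r := by
    intro r
    unfold symbolAtoms
    rcases S.sym r with _ | m | m <;> simp
  simp [atomList, this]

theorem rel_mem_atomList {S : ComputableSignature} {k r : ℕ} {t : List ℕ} :
    Sum.inr (Sum.inl (r, t)) ∈ atomList S k ↔
      r < k ∧ S.sym r = some (Sum.inl t.length) ∧ ∀ x ∈ t, x < k := by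
  have : ∀ r', (Sum.inr (Sum.inl (r, t)) : Atom) ∈ symbolAtoms S k r' ↔
      r' = r ∧ S.sym r = some (Sum.inl t.length) ∧ ∀ x ∈ t, x < k := by
    intro r'
    unfold symbolAtoms
    rcases h : S.sym r' with _ | m | m <;> simp [mem_tuplesBelow]
    · rintro rfl
      simp [h]
    · constructor
      · rintro ⟨⟨rfl, ht⟩, rfl⟩
        exact ⟨rfl, h, ht⟩
      · rintro ⟨rfl, h', ht⟩
        rw [h] at h'
        simp only [Option.some.injEq, Sum.inl.injEq] at h'
        exact ⟨⟨h'.symm, ht⟩, rfl⟩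
    · rintro rfl
      simp [h]
  simp [atomList, this]

theorem fun_mem_atomList {S : ComputableSignature} {k r y : ℕ} {t : List ℕ} :
    Sum.inr (Sum.inr (r, t, y)) ∈ atomList S k ↔
      r < k ∧ S.sym r = some (Sum.inr t.length) ∧ (∀ x ∈ t, x < k) ∧ y < k := by
  have : ∀ r', (Sum.inr (Sum.inr (r, t, y)) : Atom) ∈ symbolAtoms S k r' ↔
      r' = r ∧ S.sym r = some (Sum.inr t.length) ∧ (∀ x ∈ t, x < k) ∧ y < k := by
    intro r'
    unfold symbolAtoms
    rcases h : S.sym r' with _ | m | m <;> simp [mem_tuplesBelow]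
    · rintro rfl
      simp [h]
    · rintro rfl
      simp [h]
    · constructor
      · rintro ⟨⟨rfl, ht⟩, hy, rfl⟩
        exact ⟨rfl, h, ht, hy⟩
      · rintro ⟨rfl, h', ht, hy⟩
        rw [h] at h'
        simp only [Option.some.injEq, Sum.inr.injEq] at h'
        exact ⟨⟨h'.symm, ht⟩, hy, rfl⟩
  simp [atomList, this]

end AtomLists

/-! ### Computable atomic diagrams of tuples -/

section Literals

variable (S : ComputableSignature) (dom : ℕ → Set ℕ) [∀ i, S.lang.Structure (dom i)]

/-- The relation named by a symbol number holds of a list of elements. -/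
def RelHolds (p : ℕ × ℕ × List ℕ) : Prop :=
  ∃ (m : ℕ) (R : S.lang.Relations m) (t : Fin m → dom p.1),
    R.1 = p.2.1 ∧ List.ofFn (fun x => (t x : ℕ)) = p.2.2 ∧ Structure.RelMap R t

/-- The function named by a symbol number has the given value at a list of elements. -/
def FunHolds (p : ℕ × ℕ × List ℕ × ℕ) : Prop :=
  ∃ (m : ℕ) (F : S.lang.Functions m) (t : Fin m → dom p.1),
    F.1 = p.2.1 ∧ List.ofFn (fun x => (t x : ℕ)) = p.2.2.1 ∧
      ((Structure.funMap F t : dom p.1) : ℕ) = p.2.2.2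

/-- Truth of an atomic formula at the tuple `P.2` of the structure with number `P.1`. -/
def AtomHolds (P : ℕ × List ℕ) : Atom → Prop
  | .inl (x, y) => P.2.getD x 0 = P.2.getD y 0
  | .inr (.inl (r, t)) => RelHolds S dom (P.1, r, t.map fun x => P.2.getD x 0)
  | .inr (.inr (r, t, y)) => FunHolds S dom (P.1, r, t.map (fun x => P.2.getD x 0), P.2.getD y 0)

open Classical in
/-- The atomic diagram of a tuple, restricted to the first symbols. -/
noncomputable def literals (P : ℕ × List ℕ) : List (Atom × Bool) :=
  (atomList S P.2.length).map fun α => (α, decide (AtomHolds S dom P α))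

end Literals

section Literals

variable {S : ComputableSignature} {dom : ℕ → Set ℕ} [∀ i, S.lang.Structure (dom i)]

theorem relHolds_iff {i m : ℕ} (R : S.lang.Relations m) (t : Fin m → dom i) :
    RelHolds S dom (i, R.1, List.ofFn fun x => (t x : ℕ)) ↔ Structure.RelMap R t := by
  constructor
  · rintro ⟨m', R', t', hR, ht, h⟩
    have hm : m' = m := by simpa using congrArg List.length ht
    subst hm
    have hR' : R' = R := Subtype.ext hR
    have ht' : t' = t := funext fun x => Subtype.ext (congrFun (List.ofFn_injective ht) x)
    rwa [hR', ht'] at h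
  · exact fun h => ⟨m, R, t, rfl, rfl, h⟩

theorem funHolds_iff {i m : ℕ} (F : S.lang.Functions m) (t : Fin m → dom i) (y : dom i) :
    FunHolds S dom (i, F.1, List.ofFn (fun x => (t x : ℕ)), y) ↔ Structure.funMap F t = y := by
  constructor
  · rintro ⟨m', F', t', hF, ht, h⟩
    have hm : m' = m := by simpa using congrArg List.length ht
    subst hm
    have hF' : F' = F := Subtype.ext hF
    have ht' : t' = t := funext fun x => Subtype.ext (congrFun (List.ofFn_injective ht) x)
    rw [hF', ht'] at h
    exact Subtype.ext h
  · exact fun h => ⟨m, F, t, rfl, rfl, congrArg Subtype.val h⟩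

theorem IsComputableList.computablePred_atomHolds (hdom : IsComputableList S dom) :
    ComputablePred fun q : (ℕ × List ℕ) × Atom => AtomHolds S dom q.1 q.2 := by
  classical
  have hget : Computable₂ fun (P : ℕ × List ℕ) (x : ℕ) => P.2.getD x 0 :=
    (Primrec.list_getD 0).to_comp.comp (Computable.snd.comp Computable.fst) Computable.snd
  have hmap : Computable₂ fun (P : ℕ × List ℕ) (t : List ℕ) => t.map fun x => P.2.getD x 0 :=
    Computable.list_map Computable.snd
      (hget.comp (Computable.fst.comp Computable.fst) Computable.snd)
  have hrel : ComputablePred (RelHolds S dom) := hdom.2.1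
  have hfun : ComputablePred (FunHolds S dom) := hdom.2.2
  have h₁ : ComputablePred fun q : ((ℕ × List ℕ) × Atom) × (ℕ × ℕ) =>
      AtomHolds S dom q.1.1 (.inl q.2) :=
    Computable.eq_pred
      (hget.comp (Computable.fst.comp Computable.fst) (Computable.fst.comp Computable.snd))
      (hget.comp (Computable.fst.comp Computable.fst) (Computable.snd.comp Computable.snd))
  have hP : Computable fun r : ((ℕ × List ℕ) × Atom) ×
      ((ℕ × List ℕ) ⊕ (ℕ × List ℕ × ℕ)) => r.1.1 := Computable.fst.comp Computable.fst
  have h₂ : ComputablePred fun r : (((ℕ × List ℕ) × Atom) ×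
      ((ℕ × List ℕ) ⊕ (ℕ × List ℕ × ℕ))) × (ℕ × List ℕ) =>
        AtomHolds S dom r.1.1.1 (.inr (.inl r.2)) :=
    hrel.comp ((Computable.fst.comp (hP.comp Computable.fst)).pair
      ((Computable.fst.comp Computable.snd).pair
        (hmap.comp (hP.comp Computable.fst) (Computable.snd.comp Computable.snd))))
  have h₃ : ComputablePred fun r : (((ℕ × List ℕ) × Atom) ×
      ((ℕ × List ℕ) ⊕ (ℕ × List ℕ × ℕ))) × (ℕ × List ℕ × ℕ) =>
        AtomHolds S dom r.1.1.1 (.inr (.inr r.2)) :=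
    hfun.comp ((Computable.fst.comp (hP.comp Computable.fst)).pair
      ((Computable.fst.comp Computable.snd).pair
        ((hmap.comp (hP.comp Computable.fst)
          (Computable.fst.comp (Computable.snd.comp Computable.snd))).pair
        (hget.comp (hP.comp Computable.fst)
          (Computable.snd.comp (Computable.snd.comp Computable.snd))))))
  refine Computable.computablePred ((Computable.sumCasesOn Computable.snd h₁.decide.to₂
    (Computable.sumCasesOn Computable.snd h₂.decide.to₂ h₃.decide.to₂).to₂).of_eq ?_)
  rintro ⟨P, p | p | p⟩ <;> rfl

theorem IsComputableList.computable_literals (hdom : IsComputableList S dom) :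
    Computable (literals S dom) := by
  classical
  refine Computable.list_map
    ((computable_atomList S).comp (Computable.list_length.comp Computable.snd)) ?_
  exact Computable.snd.pair hdom.computablePred_atomHolds.decide

/-- The list of atoms depends only on the length, so the two diagrams can be compared entry by
entry. -/
theorem literals_eq_iff {P Q : ℕ × List ℕ} (h : P.2.length = Q.2.length) :
    literals S dom P = literals S dom Q ↔
      ∀ α ∈ atomList S P.2.length, (AtomHolds S dom P α ↔ AtomHolds S dom Q α) := by
  simp [literals, h, List.map_inj_left]

end Literals

/-! ### Coded tuples and the back-and-forth preorder -/

section PointedStructures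

variable {S : ComputableSignature} {dom : ℕ → Set ℕ}

/-- A tuple in the `i`-th structure, coded by `i` and the list of the entries. -/
def pointed {i k : ℕ} (a : Fin k → dom i) : ℕ × List ℕ := (i, List.ofFn fun x => (a x : ℕ))

theorem length_pointed {i k : ℕ} (a : Fin k → dom i) : (pointed a).2.length = k := by
  simp [pointed]

theorem pointed_append {i k m : ℕ} (a : Fin k → dom i) (b : Fin m → dom i) :
    pointed (Fin.append a b) = (i, (pointed a).2 ++ (pointed b).2) := by
  simp only [pointed]
  rw [← List.ofFn_fin_append]
  congr 2
  funext x
  refine Fin.addCases (fun y => ?_) (fun y => ?_) x <;> simp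

theorem mem_of_mem_pointed {i k : ℕ} (a : Fin k → dom i) : ∀ x ∈ (pointed a).2, x ∈ dom i := by
  simp [pointed, List.mem_ofFn]

theorem exists_eq_pointed {i : ℕ} {l : List ℕ} (h : ∀ x ∈ l, x ∈ dom i) :
    ∃ a : Fin l.length → dom i, pointed a = (i, l) :=
  ⟨fun x => ⟨l.get x, h _ (List.get_mem l x)⟩, by
    simp only [pointed]
    rw [List.ofFn_get]⟩

/-- The default value 0 is never reached for variables below the length of the tuple. -/
theorem getD_pointed {i k : ℕ} (a : Fin k → dom i) (x : Fin k) :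
    (pointed a).2.getD x 0 = a x := by
  simp [pointed, List.getD_eq_getElem?_getD]

theorem exists_ofFn_eq {k : ℕ} {t : List ℕ} (h : ∀ x ∈ t, x < k) :
    ∃ t' : Fin t.length → Fin k, t = List.ofFn fun x => (t' x : ℕ) :=
  ⟨fun x => ⟨t.get x, h _ (List.get_mem t x)⟩, by
    change t = List.ofFn fun x => t.get x
    rw [List.ofFn_get]⟩

theorem mem_atomList {k : ℕ} {α : Atom} : α ∈ atomList S k ↔
    (∃ x y : Fin k, α = .inl (x, y)) ∨
    (∃ (m : ℕ) (R : S.lang.Relations m) (t : Fin m → Fin k), R.1 < k ∧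
      α = .inr (.inl (R.1, List.ofFn fun x => (t x : ℕ)))) ∨
    (∃ (m : ℕ) (F : S.lang.Functions m) (t : Fin m → Fin k) (y : Fin k), F.1 < k ∧
      α = .inr (.inr (F.1, List.ofFn (fun x => (t x : ℕ)), y))) := by
  constructor
  · intro h
    rcases α with ⟨x, y⟩ | ⟨r, t⟩ | ⟨r, t, y⟩
    · obtain ⟨hx, hy⟩ := eq_mem_atomList.1 h
      exact Or.inl ⟨⟨x, hx⟩, ⟨y, hy⟩, rfl⟩
    · obtain ⟨hr, hs, ht⟩ := rel_mem_atomList.1 h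
      obtain ⟨t', ht'⟩ := exists_ofFn_eq ht
      exact Or.inr (Or.inl ⟨t.length, ⟨r, hs⟩, t', hr, by rw [← ht']⟩)
    · obtain ⟨hr, hs, ht, hy⟩ := fun_mem_atomList.1 h
      obtain ⟨t', ht'⟩ := exists_ofFn_eq ht
      exact Or.inr (Or.inr ⟨t.length, ⟨r, hs⟩, t', ⟨y, hy⟩, hr, by rw [← ht']⟩)
  · rintro (⟨x, y, rfl⟩ | ⟨m, R, t, hR, rfl⟩ | ⟨m, F, t, y, hF, rfl⟩)
    · exact eq_mem_atomList.2 ⟨x.2, y.2⟩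
    · refine rel_mem_atomList.2 ⟨hR, ?_, ?_⟩
      · rw [List.length_ofFn]; exact R.2
      · simp [List.mem_ofFn]
    · refine fun_mem_atomList.2 ⟨hF, ?_, ?_, y.2⟩
      · rw [List.length_ofFn]; exact F.2
      · simp [List.mem_ofFn]

variable [∀ i, S.lang.Structure (dom i)]

theorem atomHolds_eq {i k : ℕ} (a : Fin k → dom i) (x y : Fin k) :
    AtomHolds S dom (pointed a) (.inl (x, y)) ↔ a x = a y := by
  simp only [AtomHolds, getD_pointed, Subtype.ext_iff]

theorem map_getD_pointed {i k m : ℕ} (a : Fin k → dom i) (t : Fin m → Fin k) :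
    (List.ofFn fun x => (t x : ℕ)).map (fun x => (pointed a).2.getD x 0) =
      List.ofFn fun x => (a (t x) : ℕ) := by
  rw [List.map_ofFn]
  congr 1
  funext x
  exact getD_pointed a (t x)

theorem atomHolds_rel {i k m : ℕ} (a : Fin k → dom i) (R : S.lang.Relations m)
    (t : Fin m → Fin k) :
    AtomHolds S dom (pointed a) (.inr (.inl (R.1, List.ofFn fun x => (t x : ℕ)))) ↔
      Structure.RelMap R fun x => a (t x) := by
  simp only [AtomHolds, map_getD_pointed]
  exact relHolds_iff R _

theorem atomHolds_fun {i k m : ℕ} (a : Fin k → dom i) (F : S.lang.Functions m)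
    (t : Fin m → Fin k) (y : Fin k) :
    AtomHolds S dom (pointed a) (.inr (.inr (F.1, List.ofFn (fun x => (t x : ℕ)), y))) ↔
      Structure.funMap F (fun x => a (t x)) = a y := by
  simp only [AtomHolds, map_getD_pointed, getD_pointed]
  exact funHolds_iff F _ _

/-- Since only the first k symbols count, ≤_0 is an equality of finite computable lists. -/
theorem literals_pointed_eq_iff {i j k : ℕ} (a : Fin k → dom i) (b : Fin k → dom j) :
    literals S dom (pointed a) = literals S dom (pointed b) ↔
      SameAtomic S (dom i) (dom j) a b := by
  rw [literals_eq_iff (by rw [length_pointed, length_pointed]), length_pointed]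
  constructor
  · intro h
    refine ⟨fun x y => ?_, fun m R hR t => ?_, fun m F hF t y => ?_⟩
    · rw [← atomHolds_eq (S := S) a, ← atomHolds_eq (S := S) b]
      exact h _ (mem_atomList.2 (Or.inl ⟨x, y, rfl⟩))
    · rw [← atomHolds_rel a, ← atomHolds_rel b]
      exact h _ (mem_atomList.2 (Or.inr (Or.inl ⟨m, R, t, hR, rfl⟩)))
    · rw [← atomHolds_fun a, ← atomHolds_fun b]
      exact h _ (mem_atomList.2 (Or.inr (Or.inr ⟨m, F, t, y, hF, rfl⟩)))
  · rintro ⟨h₁, h₂, h₃⟩ α hα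
    rcases mem_atomList.1 hα with ⟨x, y, rfl⟩ | ⟨m, R, t, hR, rfl⟩ | ⟨m, F, t, y, hF, rfl⟩
    · rw [atomHolds_eq, atomHolds_eq]; exact h₁ x y
    · rw [atomHolds_rel, atomHolds_rel]; exact h₂ m R hR t
    · rw [atomHolds_fun, atomHolds_fun]; exact h₃ m F hF t y

variable (S dom) in
/-- The back-and-forth relations in terms of coded tuples. -/
def CodedBackForth : ℕ → ℕ × List ℕ → ℕ × List ℕ → Prop
  | 0, P, Q => literals S dom P = literals S dom Q
  | n + 1, P, Q => ∀ d : List ℕ, (∀ x ∈ d, x ∈ dom Q.1) →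
      ∃ c : List ℕ, (∀ x ∈ c, x ∈ dom P.1) ∧ c.length = d.length ∧
        CodedBackForth n (Q.1, Q.2 ++ d) (P.1, P.2 ++ c)

theorem codedBackForth_iff (n : ℕ) {i j k : ℕ} (a : Fin k → dom i) (b : Fin k → dom j) :
    CodedBackForth S dom n (pointed a) (pointed b) ↔ BackForth S n (dom i) (dom j) a b := by
  induction n generalizing i j k with
  | zero => exact literals_pointed_eq_iff a b
  | succ n ih =>
    constructor
    · intro h m b'
      obtain ⟨c, hc, hlen, h'⟩ := h (pointed b').2 (mem_of_mem_pointed b')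
      obtain rfl : c.length = m := by rw [hlen, length_pointed]
      obtain ⟨a', ha'⟩ := exists_eq_pointed (i := i) hc
      refine ⟨a', ?_⟩
      rw [← ih, pointed_append, pointed_append, ha']
      exact h'
    · intro h d hd
      obtain ⟨b', hb'⟩ := exists_eq_pointed (i := j) hd
      obtain ⟨a', ha'⟩ := h _ b'
      refine ⟨(pointed a').2, mem_of_mem_pointed a', length_pointed a', ?_⟩
      rw [← ih, pointed_append, pointed_append, hb'] at ha'
      exact ha'

theorem CodedBackForth.refl (n : ℕ) (P : ℕ × List ℕ) : CodedBackForth S dom n P P := by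
  induction n generalizing P with
  | zero => rfl
  | succ n ih => exact fun d hd => ⟨d, hd, rfl, ih _⟩

/-- A challenge in R is answered in Q, and that answer is in turn a challenge answered in P; the
induction hypothesis composes the reversed relations. -/
theorem CodedBackForth.trans {n : ℕ} {P Q R : ℕ × List ℕ} (h₁ : CodedBackForth S dom n P Q)
    (h₂ : CodedBackForth S dom n Q R) : CodedBackForth S dom n P R := by
  induction n generalizing P Q R with
  | zero => exact Eq.trans h₁ h₂
  | succ n ih =>
    intro d hd
    obtain ⟨c, hc, hcd, h⟩ := h₂ d hd
    obtain ⟨e, he, hec, h'⟩ := h₁ c hc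
    exact ⟨e, he, hec.trans hcd, ih h h'⟩

end PointedStructures

/-! ### Quantifier-free formulas for atomic diagrams -/

section DiagramFormulas

/-- Gödel number of an atomic formula. -/
def atomCode : Atom → ℕ
  | .inl (x, y) => 5 * Nat.pair (3 * x) (3 * y) + 1
  | .inr (.inl (r, t)) => 5 * Nat.pair r (Encodable.encode (t.map fun x => 3 * x)) + 2
  | .inr (.inr (r, t, y)) =>
      5 * Nat.pair (3 * Nat.pair r (Encodable.encode (t.map fun x => 3 * x)) + 2) (3 * y) + 1

/-- Gödel number of a literal. -/
def literalCode (q : Atom × Bool) : ℕ :=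
  bif q.2 then atomCode q.1 else 5 * Nat.pair (atomCode q.1) 0 + 3

/-- Gödel number of the negation of the conjunction of a list of literals. -/
def negConjCode (l : List (Atom × Bool)) : ℕ :=
  l.foldr (fun q e => 5 * Nat.pair (literalCode q) e + 3) 0

/-- Gödel number of the conjunction of a list of literals (for `true`), or of its negation. -/
def diagramCode (s : Bool) (l : List (Atom × Bool)) : ℕ :=
  bif s then 5 * Nat.pair (negConjCode l) 0 + 3 else negConjCode l

theorem primrec_atomCode : Primrec atomCode := by
  have hlin : ∀ c d : ℕ, Primrec fun x : ℕ => c * x + d := fun c d =>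
    Primrec.nat_add.comp (Primrec.nat_mul.comp (Primrec.const c) Primrec.id) (Primrec.const d)
  have hthree : Primrec fun x : ℕ => 3 * x := (hlin 3 0)
  have htuple : Primrec fun t : List ℕ => Encodable.encode (t.map fun x => 3 * x) :=
    Primrec.encode.comp (Primrec.list_map Primrec.id (hthree.comp Primrec.snd).to₂)
  have h₁ : Primrec fun p : ℕ × ℕ => atomCode (.inl p) :=
    (hlin 5 1).comp (Primrec₂.natPair.comp (hthree.comp Primrec.fst) (hthree.comp Primrec.snd))
  have h₂ : Primrec fun p : ℕ × List ℕ => atomCode (.inr (.inl p)) :=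
    (hlin 5 2).comp (Primrec₂.natPair.comp Primrec.fst (htuple.comp Primrec.snd))
  have h₃ : Primrec fun p : ℕ × List ℕ × ℕ => atomCode (.inr (.inr p)) :=
    (hlin 5 1).comp (Primrec₂.natPair.comp
      ((hlin 3 2).comp (Primrec₂.natPair.comp Primrec.fst
        (htuple.comp (Primrec.fst.comp Primrec.snd))))
      (hthree.comp (Primrec.snd.comp Primrec.snd)))
  refine (Primrec.sumCasesOn Primrec.id (h₁.comp Primrec.snd).to₂
    (Primrec.sumCasesOn Primrec.snd (h₂.comp Primrec.snd).to₂
      (h₃.comp Primrec.snd).to₂).to₂).of_eq ?_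
  rintro (p | p | p) <;> rfl

theorem primrec_diagramCode : Primrec₂ diagramCode := by
  have himp : Primrec₂ fun a b : ℕ => 5 * Nat.pair a b + 3 :=
    Primrec.nat_add.comp (Primrec.nat_mul.comp (Primrec.const 5)
      (Primrec₂.natPair.comp Primrec.fst Primrec.snd)) (Primrec.const 3)
  have hlit : Primrec literalCode :=
    Primrec.cond Primrec.snd (primrec_atomCode.comp Primrec.fst)
      (himp.comp (primrec_atomCode.comp Primrec.fst) (Primrec.const 0))
  have hneg : Primrec negConjCode :=
    Primrec.list_foldr Primrec.id (Primrec.const 0)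
      (himp.comp (hlit.comp (Primrec.fst.comp Primrec.snd)) (Primrec.snd.comp Primrec.snd)).to₂
  exact Primrec.cond Primrec.fst (himp.comp (hneg.comp Primrec.snd) (Primrec.const 0))
    (hneg.comp Primrec.snd)

variable {S : ComputableSignature} (dom : ℕ → Set ℕ) [∀ i, S.lang.Structure (dom i)]

theorem exists_formula_of_mem_atomList {k : ℕ} {α : Atom} (hα : α ∈ atomList S k) :
    ∃ ψ : S.lang.Formula (Fin k), BoundedFormula.IsQF ψ ∧ formulaCode S ψ = atomCode α ∧
      ∀ (j : ℕ) (v : Fin k → dom j), ψ.Realize v ↔ AtomHolds S dom (pointed v) α := by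
  rcases mem_atomList.1 hα with ⟨x, y, rfl⟩ | ⟨m, R, t, hR, rfl⟩ | ⟨m, F, t, y, hF, rfl⟩
  · refine ⟨.equal (.var (.inl x)) (.var (.inl y)),
      (BoundedFormula.IsAtomic.equal _ _).isQF, by simp [formulaCode, termCode, atomCode],
      fun j v => ?_⟩
    rw [atomHolds_eq]
    rfl
  · refine ⟨.rel R fun z => .var (.inl (t z)),
      (BoundedFormula.IsAtomic.rel _ _).isQF, ?_, fun j v => ?_⟩
    · simp only [formulaCode, termCode, atomCode, List.map_ofFn]
      rfl
    · rw [atomHolds_rel]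
      rfl
  · refine ⟨.equal (.func F fun z => .var (.inl (t z))) (.var (.inl y)),
      (BoundedFormula.IsAtomic.equal _ _).isQF, ?_, fun j v => ?_⟩
    · simp only [formulaCode, termCode, atomCode, List.map_ofFn]
      rfl
    · rw [atomHolds_fun]
      rfl

/-- The formula is the chain of implications from the literals to ⊥, whose code is a fold over the
list. -/
theorem exists_formula_negConj {k : ℕ} (l : List (Atom × Bool))
    (hl : ∀ q ∈ l, q.1 ∈ atomList S k) :
    ∃ ψ : S.lang.Formula (Fin k), BoundedFormula.IsQF ψ ∧ formulaCode S ψ = negConjCode l ∧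
      ∀ (j : ℕ) (v : Fin k → dom j), ψ.Realize v ↔
        ¬ ∀ q ∈ l, (AtomHolds S dom (pointed v) q.1 ↔ q.2 = true) := by
  induction l with
  | nil =>
    refine ⟨.falsum, .falsum, rfl, fun j v => ?_⟩
    simp only [List.not_mem_nil, false_imp_iff, implies_true, not_true_eq_false, iff_false]
    exact id
  | cons q l ih =>
    obtain ⟨ψ, hqf, hcode, hψ⟩ := ih fun q hq => hl q (by simp [hq])
    obtain ⟨χ, hqf', hcode', hχ⟩ := exists_formula_of_mem_atomList dom (hl q (by simp))
    rcases q with ⟨α, _ | _⟩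
    · refine ⟨.imp (.imp χ .falsum) ψ, (hqf'.imp .falsum).imp hqf, ?_, fun j v => ?_⟩
      · simp [formulaCode, hcode, hcode', negConjCode, literalCode]
      · have h₁ := hψ j v
        have h₂ := hχ j v
        simp only [Formula.Realize] at h₁ h₂ ⊢
        rw [BoundedFormula.realize_imp, BoundedFormula.realize_imp, h₁, h₂]
        simp [BoundedFormula.Realize]
    · refine ⟨.imp χ ψ, hqf'.imp hqf, ?_, fun j v => ?_⟩
      · simp [formulaCode, hcode, hcode', negConjCode, literalCode]
      · have h₁ := hψ j v
        have h₂ := hχ j v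
        simp only [Formula.Realize] at h₁ h₂ ⊢
        rw [BoundedFormula.realize_imp, h₁, h₂]
        simp

theorem exists_diagram_formula {k : ℕ} (s : Bool) (l : List (Atom × Bool))
    (hl : ∀ q ∈ l, q.1 ∈ atomList S k) :
    ∃ ψ : S.lang.Formula (Fin k), BoundedFormula.IsQF ψ ∧ formulaCode S ψ = diagramCode s l ∧
      ∀ (j : ℕ) (v : Fin k → dom j), ψ.Realize v ↔
        (s = true ↔ ∀ q ∈ l, (AtomHolds S dom (pointed v) q.1 ↔ q.2 = true)) := by
  obtain ⟨ψ, hqf, hcode, hψ⟩ := exists_formula_negConj dom l hl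
  rcases s with _ | _
  · refine ⟨ψ, hqf, by simp [hcode, diagramCode], fun j v => ?_⟩
    rw [hψ]
    simp
  · refine ⟨.imp ψ .falsum, hqf.imp .falsum, by simp [formulaCode, hcode, diagramCode],
      fun j v => ?_⟩
    have h := hψ j v
    simp only [Formula.Realize] at h ⊢
    rw [BoundedFormula.realize_imp, h]
    simp [BoundedFormula.Realize]

theorem literals_fst_mem {P : ℕ × List ℕ} {q : Atom × Bool} (hq : q ∈ literals S dom P) :
    q.1 ∈ atomList S P.2.length := by
  simp only [literals, List.mem_map] at hq
  obtain ⟨α, hα, rfl⟩ := hq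
  exact hα

theorem forall_literals_iff {P Q : ℕ × List ℕ} (h : P.2.length = Q.2.length) :
    (∀ q ∈ literals S dom P, (AtomHolds S dom Q q.1 ↔ q.2 = true)) ↔
      literals S dom P = literals S dom Q := by
  rw [literals_eq_iff h]
  simp only [literals, List.mem_map, forall_exists_index, and_imp, forall_apply_eq_imp_iff₂,
    decide_eq_true_eq]
  exact forall₂_congr fun α _ => Iff.comm

end DiagramFormulas

/-! ### The extension game and its arithmetical complexity -/

section ExtensionGame

/-- A coded tuple in one of the structures. -/
abbrev CodedTuple : Type := ℕ × List ℕ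

variable (S : ComputableSignature) (dom : ℕ → Set ℕ) [∀ i, S.lang.Structure (dom i)]

/-- The list `z` extends the first tuple to one with the atomic diagram of the second. -/
def AtomicExtension (q : (CodedTuple × CodedTuple) × List ℕ) : Prop :=
  (∀ x ∈ q.2, x ∈ dom q.1.1.1) ∧ (q.1.1.2 ++ q.2).length = q.1.2.2.length ∧
    literals S dom q.1.2 = literals S dom (q.1.1.1, q.1.1.2 ++ q.2)

/-- The first tuple may be extended by `z`; at odd levels it has to reach the length of the
second tuple. -/
def ExtensionMove (q : ℕ × (CodedTuple × CodedTuple) × List ℕ) : Prop :=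
  (∀ x ∈ q.2.2, x ∈ dom q.2.1.1.1) ∧
    (q.1.bodd = false ∨ (q.2.1.1.2 ++ q.2.2).length = q.2.1.2.2.length)

/-- The position after a move: the tuples change places at even levels. -/
def afterMove (q : ℕ × (CodedTuple × CodedTuple) × List ℕ) : CodedTuple × CodedTuple :=
  bif q.1.bodd then ((q.2.1.1.1, q.2.1.1.2 ++ q.2.2), q.2.1.2)
  else (q.2.1.2, (q.2.1.1.1, q.2.1.1.2 ++ q.2.2))

/-- Level `2 * n` of this game says that the first tuple extends to one that the second is
`n`-below, see `extensionWon_two_mul`. -/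
def ExtensionWon : ℕ → CodedTuple × CodedTuple → Prop :=
  gameWon (AtomicExtension S dom) (ExtensionMove dom) afterMove

/-- Two levels of the game unfold one back-and-forth step: choose z, after which every further d
must leave a won position with the tuples exchanged. -/
theorem extensionWon_two_mul (n : ℕ) (P Q : CodedTuple) :
    ExtensionWon S dom (2 * n) (P, Q) ↔ ∃ z : List ℕ, (∀ x ∈ z, x ∈ dom P.1) ∧
      (P.2 ++ z).length = Q.2.length ∧ CodedBackForth S dom n Q (P.1, P.2 ++ z) := by
  induction n generalizing P Q with
  | zero => rfl
  | succ n ih =>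
    have hodd : (2 * n + 1).bodd = true := by simp
    have heven : (2 * n).bodd = false := by simp
    -- Moves carry the level they lead to. The one to 2n + 1 (odd) must reach the length of Q and
    -- keeps the places; the one to 2n (even) has arbitrary length and exchanges them.
    have hstep : ExtensionWon S dom (2 * (n + 1)) (P, Q) ↔
        ∃ z : List ℕ, ((∀ x ∈ z, x ∈ dom P.1) ∧ (P.2 ++ z).length = Q.2.length) ∧
          ¬ ∃ d : List ℕ, (∀ x ∈ d, x ∈ dom P.1) ∧
            ¬ ExtensionWon S dom (2 * n) (Q, (P.1, P.2 ++ z ++ d)) := by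
      rw [show 2 * (n + 1) = 2 * n + 1 + 1 by ring]
      simp only [ExtensionWon, gameWon, ExtensionMove, afterMove, hodd, heven, cond_true,
        cond_false, Bool.true_eq_false, false_or, true_or, and_true]
    rw [hstep]
    refine exists_congr fun z => ?_
    rw [and_assoc]
    refine and_congr_right fun _ => and_congr_right fun hlen => ?_
    push Not
    refine forall₂_congr fun d _ => ?_
    rw [ih]
    refine exists_congr fun c => and_congr_right fun _ => and_congr_left fun _ => ?_
    -- As Pz and Q have equal length, equal total lengths amount to |c| = |d|.
    simp only [List.length_append] at hlen ⊢
    omega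

variable {S dom}

theorem IsComputableList.computablePred_within (hdom : IsComputableList S dom) :
    ComputablePred fun P : CodedTuple => ∀ x ∈ P.2, x ∈ dom P.1 :=
  ComputablePred.forall_mem_list (p := fun (P : CodedTuple) x => x ∈ dom P.1)
    (hdom.1.comp ((Computable.fst.comp Computable.fst).pair Computable.snd)) Computable.snd

theorem IsComputableList.computablePred_atomicExtension (hdom : IsComputableList S dom) :
    ComputablePred (AtomicExtension S dom) := by
  have hi : Computable fun q : (CodedTuple × CodedTuple) × List ℕ => q.1.1.1 :=
    Computable.fst.comp (Computable.fst.comp Computable.fst)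
  have hl : Computable fun q : (CodedTuple × CodedTuple) × List ℕ => q.1.1.2 ++ q.2 :=
    Computable.list_append.comp (Computable.snd.comp (Computable.fst.comp Computable.fst))
      Computable.snd
  have hQ : Computable fun q : (CodedTuple × CodedTuple) × List ℕ => q.1.2 :=
    Computable.snd.comp Computable.fst
  exact (hdom.computablePred_within.comp (hi.pair Computable.snd)).and
    ((Computable.eq_pred (Computable.list_length.comp hl)
      (Computable.list_length.comp (Computable.snd.comp hQ))).and
    (Computable.eq_pred (hdom.computable_literals.comp hQ)
      (hdom.computable_literals.comp (hi.pair hl))))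

theorem IsComputableList.computablePred_extensionMove (hdom : IsComputableList S dom) :
    ComputablePred (ExtensionMove dom) := by
  have hP : Computable fun q : ℕ × (CodedTuple × CodedTuple) × List ℕ => q.2.1.1 :=
    Computable.fst.comp (Computable.fst.comp Computable.snd)
  have hQ : Computable fun q : ℕ × (CodedTuple × CodedTuple) × List ℕ => q.2.1.2 :=
    Computable.snd.comp (Computable.fst.comp Computable.snd)
  have hz : Computable fun q : ℕ × (CodedTuple × CodedTuple) × List ℕ => q.2.2 :=
    Computable.snd.comp Computable.snd
  exact (hdom.computablePred_within.comp ((Computable.fst.comp hP).pair hz)).and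
    ((Computable.eq_pred (Computable.nat_bodd.comp Computable.fst) (Computable.const false)).or
      (Computable.eq_pred
        (Computable.list_length.comp (Computable.list_append.comp (Computable.snd.comp hP) hz))
        (Computable.list_length.comp (Computable.snd.comp hQ))))

theorem computable_afterMove : Computable afterMove := by
  have hP : Computable fun q : ℕ × (CodedTuple × CodedTuple) × List ℕ => q.2.1.1 :=
    Computable.fst.comp (Computable.fst.comp Computable.snd)
  have hQ : Computable fun q : ℕ × (CodedTuple × CodedTuple) × List ℕ => q.2.1.2 :=
    Computable.snd.comp (Computable.fst.comp Computable.snd)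
  have hz : Computable fun q : ℕ × (CodedTuple × CodedTuple) × List ℕ => q.2.2 :=
    Computable.snd.comp Computable.snd
  have hPz := (Computable.fst.comp hP).pair
    (Computable.list_append.comp (Computable.snd.comp hP) hz)
  exact Computable.cond (Computable.nat_bodd.comp Computable.fst) (hPz.pair hQ) (hQ.pair hPz)

/-- Questions about the game at low levels reduce uniformly to the jumps. -/
theorem IsComputableList.exists_extensionWon_reduction (hdom : IsComputableList S dom) :
    ∃ r : ℕ × ℕ × CodedTuple × CodedTuple → ℕ, Computable r ∧
      ∀ N p x, p + 1 ≤ N → (r (N, p, x) ∈ zeroJump N ↔ ExtensionWon S dom p x) := by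
  obtain ⟨t, ht, htw⟩ := exists_gameWon_index hdom.computablePred_atomicExtension
    hdom.computablePred_extensionMove computable_afterMove
  obtain ⟨u, hu, huw⟩ := exists_iterated_jump_embedding
  -- Level p is a question to the jump number p + 1, lifted through the remaining N - (p + 1) jumps;
  -- the subtraction is genuine because p + 1 ≤ N.
  refine ⟨fun q => u (q.1 - (q.2.1 + 1), t q.2), ?_, fun N p x hN => ?_⟩
  · exact hu.comp ((Primrec.nat_sub.to_comp.comp Computable.fst
      (Computable.succ.comp (Computable.fst.comp Computable.snd))).pair
        (ht.comp Computable.snd))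
  · have := huw (N - (p + 1)) (p + 1) (t (p, x))
    rw [Nat.add_sub_cancel' hN] at this
    rw [this, ExtensionWon, htw]

end ExtensionGame

/-! ### States, their refutations and computable indices -/

section StateFormulas

/-- A state stands for a condition on a tuple: the state `(some P, some (p, x))` says that `P` is
below the tuple in the back-and-forth order and that `x` is not won at level `p` of the extension
game; either half may be missing. -/
abbrev FormulaState : Type := Option CodedTuple × Option (ℕ × CodedTuple × CodedTuple)

variable (S : ComputableSignature) (dom : ℕ → Set ℕ) [∀ i, S.lang.Structure (dom i)]

/-- The condition on `Q` expressed by a state at level `n`. -/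
def StateHolds (n : ℕ) (s : FormulaState) (Q : CodedTuple) : Prop :=
  (∀ P, s.1 = some P → CodedBackForth S dom n P Q) ∧
    ∀ p x, s.2 = some (p, x) → ¬ ExtensionWon S dom p x

/-- The data `w` witness that `s'` is a refutation of `s`, with `m` additional entries. -/
def ChildWitness (q : ℕ × FormulaState × ℕ × FormulaState)
    (w : ℕ × (CodedTuple × CodedTuple) × List ℕ) : Prop :=
  (q.2.1.1 = some w.2.1.1 ∧ q.2.2.2 = (some w.2.1.2, some (2 * q.1, w.2.1)) ∧
    (∀ x ∈ w.2.1.2.2, x ∈ dom w.2.1.2.1) ∧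
    w.2.1.2.2.length = w.2.1.1.2.length + q.2.2.1) ∨
  (q.2.1.2 = some (w.1 + 1, w.2.1) ∧ q.2.2.1 = 0 ∧ ExtensionMove dom w ∧
    q.2.2.2 = (none, some (w.1, afterMove w)))

/-- At level `n + 1` the state `s` is the conjunction of the negations of its children `s'`, which
have level `n` and `m` additional entries. -/
def IsChild (n : ℕ) (s : FormulaState) (m : ℕ) (s' : FormulaState) : Prop :=
  ∃ w, ChildWitness dom (n, s, m, s') w

/-- The states that occur at level `n` in the formulas computable from `0^(N)`. -/
def StateValid (N n k : ℕ) (s : FormulaState) : Prop :=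
  n ≤ N ∧ (∀ P, s.1 = some P → (∀ x ∈ P.2, x ∈ dom P.1) ∧ P.2.length = k) ∧
    ∀ p x, s.2 = some (p, x) → n ≤ p ∧ p + 1 ≤ N + n

/-- The atomic diagram described by a state at level `0`. -/
noncomputable def stateLiterals (s : FormulaState) : List (Atom × Bool) :=
  Option.casesOn s.1 [] fun P => literals S dom P

variable {S dom}

theorem isChild_iff {n m : ℕ} {s s' : FormulaState} : IsChild dom n s m s' ↔
    (∃ P P' : CodedTuple, s.1 = some P ∧ s' = (some P', some (2 * n, P, P')) ∧
      (∀ x ∈ P'.2, x ∈ dom P'.1) ∧ P'.2.length = P.2.length + m) ∨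
    (∃ w, s.2 = some (w.1 + 1, w.2.1) ∧ m = 0 ∧ ExtensionMove dom w ∧
      s' = (none, some (w.1, afterMove w))) := by
  constructor
  · rintro ⟨w, h | h⟩
    · exact Or.inl ⟨w.2.1.1, w.2.1.2, h⟩
    · exact Or.inr ⟨w, h⟩
  · rintro (⟨P, P', h⟩ | ⟨w, h⟩)
    -- The first alternative does not look at the level and the move, so 0 and `[]` are
    -- placeholders.
    · exact ⟨(0, (P, P'), []), Or.inl h⟩
    · exact ⟨w, Or.inr h⟩

/-- A new game position has p = 2n, and 2n + 1 ≤ N + n because n + 1 ≤ N; an inherited one drops by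
one level together with the formula. Both bounds thus persist. -/
theorem IsChild.stateValid {N n k m : ℕ} {s s' : FormulaState} (h : IsChild dom n s m s')
    (hs : StateValid dom N (n + 1) k s) : StateValid dom N n (k + m) s' := by
  obtain ⟨hN, h₁, h₂⟩ := hs
  rcases isChild_iff.1 h with ⟨P, P', hP, rfl, hdomw, hlen⟩ | ⟨w, hp, rfl, _, rfl⟩
  · refine ⟨by omega, ?_, ?_⟩
    · rintro P₁ hP₁
      obtain rfl : P' = P₁ := by simpa using hP₁
      exact ⟨hdomw, by rw [hlen, (h₁ _ hP).2]⟩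
    · rintro p x hx
      simp only [Option.some.injEq, Prod.mk.injEq] at hx
      omega
  · refine ⟨by omega, by simp, ?_⟩
    rintro p x hx
    simp only [Option.some.injEq, Prod.mk.injEq] at hx
    have := h₂ _ _ hp
    omega

/-- Guarantees that an enumerated leaf has a game position about which the oracle can be asked. -/
theorem IsChild.exists_snd_eq {n m : ℕ} {s s' : FormulaState} (h : IsChild dom n s m s') :
    ∃ p x, s'.2 = some (p, x) := by
  rcases isChild_iff.1 h with ⟨P, P', _, rfl, _⟩ | ⟨w, _, _, _, rfl⟩
  · exact ⟨_, _, rfl⟩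
  · exact ⟨_, _, rfl⟩

/-- Each half of the state is a conjunction of negations: a back-and-forth failure is exhibited by
some P' that no extension of P lies n-above, and a win by a move to a position not won. -/
theorem stateHolds_succ_iff {N n k : ℕ} {s : FormulaState} (hs : StateValid dom N (n + 1) k s)
    {Q : CodedTuple} (hQ : ∀ x ∈ Q.2, x ∈ dom Q.1) (hk : Q.2.length = k) :
    StateHolds S dom (n + 1) s Q ↔ ∀ m s', IsChild dom n s m s' →
      ∀ y : List ℕ, (∀ x ∈ y, x ∈ dom Q.1) → y.length = m →
        ¬ StateHolds S dom n s' (Q.1, Q.2 ++ y) := by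
  constructor
  · rintro ⟨h₁, h₂⟩ m s' h y hy rfl ⟨h₁', h₂'⟩
    rcases isChild_iff.1 h with ⟨P, P', hP, rfl, hP', hlen⟩ | ⟨⟨p, x, z⟩, hp, hm, hmove, rfl⟩
    · refine h₂' _ _ rfl ((extensionWon_two_mul S dom n P P').2 ?_)
      obtain ⟨c, hc, hcy, hbf⟩ := h₁ P hP y hy
      refine ⟨c, hc, ?_, (h₁' _ rfl).trans hbf⟩
      rw [List.length_append, hlen, hcy]
    · exact h₂ _ _ hp ⟨z, hmove, h₂' _ _ rfl⟩
  · intro h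
    refine ⟨fun P hP d hd => ?_, fun p' x hp hwon => ?_⟩
    · by_contra hcon
      have hlen := (hs.2.1 P hP).2
      -- If P has no answer to d, then P' = Qd refutes the state: it is n-below itself, and a win of
      -- its game would be an answer.
      refine h d.length (some (Q.1, Q.2 ++ d), some (2 * n, P, (Q.1, Q.2 ++ d)))
        (isChild_iff.2 (Or.inl ⟨P, _, hP, rfl, ?_, ?_⟩)) d hd rfl ⟨?_, ?_⟩
      · intro x hx
        rcases List.mem_append.1 hx with hx | hx
        · exact hQ x hx
        · exact hd x hx
      · simp only [List.length_append]
        omega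
      · rintro P' hP'
        obtain rfl : (Q.1, Q.2 ++ d) = P' := by simpa using hP'
        exact CodedBackForth.refl n _
      · rintro p x hx hwon
        simp only [Option.some.injEq, Prod.mk.injEq] at hx
        obtain ⟨rfl, rfl⟩ := hx
        obtain ⟨z, hz, hzl, hbf⟩ := (extensionWon_two_mul S dom n _ _).1 hwon
        refine hcon ⟨z, hz, ?_, hbf⟩
        simp only [List.length_append] at hzl
        omega
    -- Validity gives n + 1 ≤ p', so there is still a level of the game to strip.
    · obtain ⟨p, rfl⟩ : ∃ p, p' = p + 1 := ⟨p' - 1, by have := (hs.2.2 _ _ hp).1; omega⟩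
      obtain ⟨z, hmove, hnext⟩ := hwon
      refine h 0 (none, some (p, afterMove (p, x, z)))
        (isChild_iff.2 (Or.inr ⟨(p, x, z), hp, rfl, hmove, rfl⟩)) [] (by simp) rfl ⟨by simp, ?_⟩
      rintro p₁ x₁ hx
      simp only [Option.some.injEq, Prod.mk.injEq] at hx
      obtain ⟨rfl, rfl⟩ := hx
      exact hnext

theorem IsComputableList.computable_stateLiterals (hdom : IsComputableList S dom) :
    Computable (stateLiterals S dom) :=
  Computable.option_casesOn Computable.fst (Computable.const [])
    (hdom.computable_literals.comp Computable.snd).to₂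

theorem IsComputableList.computablePred_childWitness (hdom : IsComputableList S dom) :
    ComputablePred fun q : (ℕ × FormulaState × ℕ × FormulaState) ×
      (ℕ × (CodedTuple × CodedTuple) × List ℕ) => ChildWitness dom q.1 q.2 := by
  let D := (ℕ × FormulaState × ℕ × FormulaState) × (ℕ × (CodedTuple × CodedTuple) × List ℕ)
  have hn : Computable fun q : D => q.1.1 := Computable.fst.comp Computable.fst
  have hs : Computable fun q : D => q.1.2.1 :=
    Computable.fst.comp (Computable.snd.comp Computable.fst)
  have hm : Computable fun q : D => q.1.2.2.1 :=
    Computable.fst.comp (Computable.snd.comp (Computable.snd.comp Computable.fst))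
  have hs' : Computable fun q : D => q.1.2.2.2 :=
    Computable.snd.comp (Computable.snd.comp (Computable.snd.comp Computable.fst))
  have hp : Computable fun q : D => q.2.1 := Computable.fst.comp Computable.snd
  have hx : Computable fun q : D => q.2.2.1 :=
    Computable.fst.comp (Computable.snd.comp Computable.snd)
  have hP : Computable fun q : D => q.2.2.1.1 := Computable.fst.comp hx
  have hP' : Computable fun q : D => q.2.2.1.2 := Computable.snd.comp hx
  have hdouble : Computable fun q : D => 2 * q.1.1 :=
    Primrec.nat_mul.to_comp.comp (Computable.const 2) hn
  have h₁ := (Computable.eq_pred (Computable.fst.comp hs) (Computable.option_some.comp hP)).and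
    ((Computable.eq_pred hs' ((Computable.option_some.comp hP').pair
      (Computable.option_some.comp (hdouble.pair hx)))).and
    ((hdom.computablePred_within.comp hP').and
    (Computable.eq_pred (Computable.list_length.comp (Computable.snd.comp hP'))
      (Primrec.nat_add.to_comp.comp (Computable.list_length.comp (Computable.snd.comp hP)) hm))))
  have h₂ := (Computable.eq_pred (Computable.snd.comp hs)
      (Computable.option_some.comp ((Computable.succ.comp hp).pair hx))).and
    ((Computable.eq_pred hm (Computable.const 0)).and
    ((hdom.computablePred_extensionMove.comp (Computable.snd : Computable fun q : D => q.2)).and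
    (Computable.eq_pred hs' ((Computable.const none).pair
      (Computable.option_some.comp (hp.pair
        (computable_afterMove.comp (Computable.snd : Computable fun q : D => q.2))))))))
  exact h₁.or h₂

open Nat.Partrec in
/-- The index of the formula of a state, for `q = (N, s, n, state)`, where the program `c` lists the
subformulas. -/
noncomputable def stateIndex (S : ComputableSignature) (dom : ℕ → Set ℕ)
    [∀ i, S.lang.Structure (dom i)] (c : Code) (q : ℕ × Bool × ℕ × FormulaState) : ℕ :=
  Nat.casesOn q.2.2.1 (diagramCode q.2.1 (stateLiterals S dom q.2.2.2)) fun _ => sectionIndex c q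

open Nat.Partrec in
theorem IsComputableList.computable_stateIndex (hdom : IsComputableList S dom) :
    Computable₂ (stateIndex S dom) := by
  have hn : Computable fun q : Code × (ℕ × Bool × ℕ × FormulaState) => q.2.2.2.1 :=
    Computable.fst.comp (Computable.snd.comp (Computable.snd.comp Computable.snd))
  have hs : Computable fun q : Code × (ℕ × Bool × ℕ × FormulaState) => q.2.2.1 :=
    Computable.fst.comp (Computable.snd.comp Computable.snd)
  have hst : Computable fun q : Code × (ℕ × Bool × ℕ × FormulaState) => q.2.2.2.2 :=
    Computable.snd.comp (Computable.snd.comp (Computable.snd.comp Computable.snd))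
  exact Computable.nat_casesOn hn
    (primrec_diagramCode.to_comp.comp hs (hdom.computable_stateLiterals.comp hst))
    (computable_sectionIndex.comp (Computable.fst.comp Computable.fst)
      (Computable.snd.comp Computable.fst)).to₂

/-- A family of indices for the formulas of the states. -/
structure IsStateIndexing (S : ComputableSignature) (dom : ℕ → Set ℕ)
    [∀ i, S.lang.Structure (dom i)] (g : ℕ × Bool × ℕ × FormulaState → ℕ) : Prop where
  zero : ∀ N s st, g (N, s, 0, st) = diagramCode s (stateLiterals S dom st)
  succ : ∀ N s n st k, StateValid dom N (n + 1) k st → ∀ y,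
    (y ∈ oracleW (zeroJump N) (g (N, s, n + 1, st)) ↔
      ∃ st', IsChild dom n st y.unpair.1 st' ∧ y.unpair.2 = g (N, !s, n, st') ∧
        (n = 0 → ∀ p x, st'.2 = some (p, x) → ¬ ExtensionWon S dom p x))

open Nat.Partrec in
/-- The formulas of the states have uniformly computable indices. -/
theorem IsComputableList.exists_stateIndex (hdom : IsComputableList S dom) :
    ∃ g : ℕ × Bool × ℕ × FormulaState → ℕ, Computable g ∧ IsStateIndexing S dom g := by
  obtain ⟨r, hr, hrw⟩ := hdom.exists_extensionWon_reduction
  let W := ℕ × FormulaState × (ℕ × (CodedTuple × CodedTuple) × List ℕ) ×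
    (ℕ × CodedTuple × CodedTuple)
  -- The guessed data are the lower level, the child, its witness and its game position. The oracle
  -- is consulted only when the children have level 0, where the position must not be won; children
  -- change the side.
  let K : Code × ((ℕ × Bool × ℕ × FormulaState) × ℕ × List Bool) × W → Prop := fun q =>
    q.2.1.1.2.2.1 = q.2.2.1 + 1 ∧
    ChildWitness dom (q.2.2.1, q.2.1.1.2.2.2, q.2.1.2.1.unpair.1, q.2.2.2.1) q.2.2.2.2.1 ∧
    q.2.1.2.1.unpair.2 =
      stateIndex S dom q.1 (q.2.1.1.1, !q.2.1.1.2.1, q.2.2.1, q.2.2.2.1) ∧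
    (¬ q.2.2.1 = 0 ∨ (q.2.2.2.1.2 = some q.2.2.2.2.2 ∧
      q.2.1.2.2[r (q.2.1.1.1, q.2.2.2.2.2)]? = some false))
  have hK : ComputablePred K := by
    let D := Code × ((ℕ × Bool × ℕ × FormulaState) × ℕ × List Bool) × W
    have hq : Computable fun q : D => q.2.1.1 :=
      Computable.fst.comp (Computable.fst.comp Computable.snd)
    have hN : Computable fun q : D => q.2.1.1.1 := Computable.fst.comp hq
    have hs : Computable fun q : D => q.2.1.1.2.1 := Computable.fst.comp (Computable.snd.comp hq)
    have hn : Computable fun q : D => q.2.1.1.2.2.1 :=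
      Computable.fst.comp (Computable.snd.comp (Computable.snd.comp hq))
    have hst : Computable fun q : D => q.2.1.1.2.2.2 :=
      Computable.snd.comp (Computable.snd.comp (Computable.snd.comp hq))
    have hy : Computable fun q : D => q.2.1.2.1.unpair :=
      Computable.unpair.comp
        (Computable.fst.comp (Computable.snd.comp (Computable.fst.comp Computable.snd)))
    have hσ : Computable fun q : D => q.2.1.2.2 :=
      Computable.snd.comp (Computable.snd.comp (Computable.fst.comp Computable.snd))
    have hw : Computable fun q : D => q.2.2 := Computable.snd.comp Computable.snd
    have hn' : Computable fun q : D => q.2.2.1 := Computable.fst.comp hw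
    have hst' : Computable fun q : D => q.2.2.2.1 := Computable.fst.comp (Computable.snd.comp hw)
    have hwit : Computable fun q : D => q.2.2.2.2.1 :=
      Computable.fst.comp (Computable.snd.comp (Computable.snd.comp hw))
    have hv : Computable fun q : D => q.2.2.2.2.2 :=
      Computable.snd.comp (Computable.snd.comp (Computable.snd.comp hw))
    have hns : Computable fun q : D => !q.2.1.1.2.1 := Primrec.not.to_comp.comp hs
    exact (Computable.eq_pred hn (Computable.succ.comp hn')).and
      ((hdom.computablePred_childWitness.comp
        ((hn'.pair (hst.pair ((Computable.fst.comp hy).pair hst'))).pair hwit)).and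
      ((Computable.eq_pred (Computable.snd.comp hy)
        (hdom.computable_stateIndex.comp Computable.fst
          (hN.pair (hns.pair (hn'.pair hst'))))).and
      ((Computable.eq_pred hn' (Computable.const 0)).not.or
        ((Computable.eq_pred (Computable.snd.comp hst') (Computable.option_some.comp hv)).and
          (Computable.eq_pred (Computable.list_getElem?.comp hσ (hr.comp (hN.pair hv)))
            (Computable.const _))))))
  obtain ⟨c, hc⟩ := exists_selfReferential_index hK
  refine ⟨stateIndex S dom c, hdom.computable_stateIndex.comp (Computable.const c) Computable.id,
    fun _ _ _ => rfl, fun N s n st k hst y => ?_⟩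
  have hsec : stateIndex S dom c (N, s, n + 1, st) = sectionIndex c (N, s, n + 1, st) := rfl
  rw [hsec, hc]
  constructor
  · rintro ⟨σ, hσ, ⟨n', st', w, v⟩, hn, hchild, hidx, hleaf⟩
    obtain rfl : n = n' := Nat.succ_injective hn
    have hchild' : IsChild dom n st y.unpair.1 st' := ⟨w, hchild⟩
    refine ⟨st', hchild', hidx, ?_⟩
    rintro rfl p x hpx
    obtain ⟨hv, hσv⟩ := hleaf.resolve_left (by simp)
    obtain rfl : (p, x) = v := Option.some_injective _ (hpx.symm.trans hv)
    -- At level 0 the invariant reads p + 1 ≤ N, exactly what the reduction to 0^(N) needs.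
    have hval := ((hchild'.stateValid hst).2.2 p x hpx).2
    rw [← hrw N p x hval]
    have := hσ _ _ hσv
    simpa using this
  · rintro ⟨st', ⟨w, hw⟩, hidx, hleaf⟩
    have hchild' : IsChild dom n st y.unpair.1 st' := ⟨w, hw⟩
    obtain ⟨p, x, hpx⟩ := hchild'.exists_snd_eq
    by_cases hn : n = 0
    · subst hn
      have hval := ((hchild'.stateValid hst).2.2 p x hpx).2
      have hno := hleaf rfl p x hpx
      rw [← hrw N p x hval] at hno
      obtain ⟨σ, hσ, hσv⟩ := (exists_isInitialSegment (zeroJump N) (r (N, p, x)) false).2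
        (by simpa using hno)
      exact ⟨σ, hσ, (0, st', w, (p, x)), rfl, hw, hidx, Or.inr ⟨hpx, hσv⟩⟩
    · exact ⟨[], fun m b h => by simp at h, (n, st', w, (p, x)), rfl, hw, hidx, Or.inl hn⟩

end StateFormulas

/-! ### Meaning of the indexed formulas and the theorem -/

section Main

/-- The formulas on the side `Π` are positive, those on the side `Σ` are negated. -/
def Side.isPi : Side → Bool
  | .sigma => false
  | .pi => true

theorem Side.isPi_dual (s : Side) : s.dual.isPi = !s.isPi := by
  cases s <;> rfl

theorem exists_eq_pointed_of_length {dom : ℕ → Set ℕ} {j k : ℕ} {l : List ℕ}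
    (h : ∀ x ∈ l, x ∈ dom j) (hk : l.length = k) : ∃ y : Fin k → dom j, pointed y = (j, l) := by
  subst hk
  exact exists_eq_pointed h

/-- Reads a Σ node as the negation of a universal statement, so that both sides share one induction.
-/
theorem InfFormula.realize_node_iff {L : FirstOrder.Language.{0, 0}} {M : Type} [L.Structure M]
    {s : Side} {n k : ℕ} {C : Set ℕ} {m : C → ℕ}
    {ψ : (c : C) → InfFormula L s.dual n (k + m c)} {v : Fin k → M} :
    (InfFormula.node C m ψ).Realize M v ↔
      (s.isPi = true ↔ ∀ (c : C) (y : Fin (m c) → M),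
        ((ψ c).Realize M (Fin.append v y) ↔ s.isPi = true)) := by
  cases s <;> simp [InfFormula.Realize, Side.isPi]

variable {S : ComputableSignature} {dom : ℕ → Set ℕ} [∀ i, S.lang.Structure (dom i)]

theorem mem_atomList_of_mem_stateLiterals {N k : ℕ} {st : FormulaState}
    (hst : StateValid dom N 0 k st) {q : Atom × Bool} (hq : q ∈ stateLiterals S dom st) :
    q.1 ∈ atomList S k := by
  rcases st with ⟨_ | P, o⟩
  · simp [stateLiterals] at hq
  · rw [← (hst.2.1 P rfl).2]
    exact literals_fst_mem dom hq

/-- The diagram at a leaf omits the game position, whose condition must already be known to be true.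
-/
theorem forall_stateLiterals_iff {N k : ℕ} {st : FormulaState} (hst : StateValid dom N 0 k st)
    (hwon : ∀ p x, st.2 = some (p, x) → ¬ ExtensionWon S dom p x) {Q : CodedTuple}
    (hQ : Q.2.length = k) :
    (∀ q ∈ stateLiterals S dom st, (AtomHolds S dom Q q.1 ↔ q.2 = true)) ↔
      StateHolds S dom 0 st Q := by
  rcases st with ⟨_ | P, o⟩
  · simpa [stateLiterals, StateHolds] using hwon
  · have hlen : P.2.length = Q.2.length := by rw [(hst.2.1 P rfl).2, hQ]
    refine (forall_literals_iff dom hlen).trans ⟨fun h => ⟨?_, hwon⟩, fun h => h.1 P rfl⟩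
    rintro P' hP'
    obtain rfl : P = P' := by simpa using hP'
    exact h

theorem IsStateIndexing.exists_isIndex {g : ℕ × Bool × ℕ × FormulaState → ℕ}
    (hg : IsStateIndexing S dom g) {N n k : ℕ} {st : FormulaState}
    (hst : StateValid dom N n k st) (s : Side) :
    ∃ φ : InfFormula S.lang s n k, IsIndex S (zeroJump N) φ (g (N, s.isPi, n, st)) := by
  induction n generalizing k st s with
  | zero =>
    obtain ⟨ψ, hqf, hcode, _⟩ := exists_diagram_formula dom s.isPi (stateLiterals S dom st)
      fun q hq => mem_atomList_of_mem_stateLiterals hst hq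
    exact ⟨.qf ψ hqf, hcode.trans (hg.zero N s.isPi st).symm⟩
  | succ n ih =>
    have hsub : ∀ c : oracleW (zeroJump N) (g (N, s.isPi, n + 1, st)),
        ∃ φ : InfFormula S.lang s.dual n (k + (Nat.unpair c).1),
          IsIndex S (zeroJump N) φ (Nat.unpair c).2 := by
      rintro ⟨c, hc⟩
      obtain ⟨st', hchild, hidx, _⟩ := (hg.succ N s.isPi n st k hst c).1 hc
      have h := ih (hchild.stateValid hst) s.dual
      rw [s.isPi_dual, ← hidx] at h
      exact h
    choose ψ hψ using hsub
    exact ⟨.node _ _ ψ, rfl, fun c => ⟨rfl, hψ c⟩⟩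

/-- Holds for every formula with the given index, so no particular choice of subformulas matters. A
Π formula expresses its state and a Σ formula the negation. -/
theorem IsStateIndexing.realize_iff {g : ℕ × Bool × ℕ × FormulaState → ℕ}
    (hg : IsStateIndexing S dom g) {N n k : ℕ} {st : FormulaState}
    (hst : StateValid dom N n k st)
    (hwon : n = 0 → ∀ p x, st.2 = some (p, x) → ¬ ExtensionWon S dom p x) {s : Side}
    (φ : InfFormula S.lang s n k) (hφ : IsIndex S (zeroJump N) φ (g (N, s.isPi, n, st)))
    {j : ℕ} (v : Fin k → dom j) :
    φ.Realize (dom j) v ↔ (s.isPi = true ↔ StateHolds S dom n st (pointed v)) := by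
  induction n generalizing k st s with
  | zero =>
    obtain ⟨ψ, hqf⟩ := φ
    obtain ⟨ψ', _, hcode, hψ'⟩ := exists_diagram_formula dom s.isPi (stateLiterals S dom st)
      fun q hq => mem_atomList_of_mem_stateLiterals hst hq
    have hcode' : formulaCode S ψ = formulaCode S ψ' := by
      rw [hcode, ← hg.zero N]
      exact hφ
    obtain rfl : ψ = ψ' := formulaCode_injective S _ _ hcode'
    have h := hψ' j v
    rw [forall_stateLiterals_iff hst (hwon rfl) (length_pointed v)] at h
    exact h
  | succ n ih =>
    obtain _ | ⟨C, m, ψ⟩ := φ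
    obtain ⟨hC, hsub⟩ := hφ
    rw [InfFormula.realize_node_iff,
      stateHolds_succ_iff hst (mem_of_mem_pointed v) (length_pointed v)]
    refine iff_congr Iff.rfl ⟨fun h m' st' hchild y hy hlen hholds => ?_, fun h c y => ?_⟩
    -- A child that holds satisfies its own game condition, so it passes the filter even when n = 0.
    · have hmem : Nat.pair m' (g (N, !s.isPi, n, st')) ∈ C := by
        rw [hC, hg.succ N s.isPi n st k hst]
        exact ⟨st', by simpa using hchild, by simp, fun _ => hholds.2⟩
      obtain ⟨c, hc⟩ : ∃ c : C, Nat.unpair c = (m', g (N, s.dual.isPi, n, st')) :=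
        ⟨⟨_, hmem⟩, by rw [Nat.unpair_pair, s.isPi_dual]⟩
      obtain ⟨hm, hidx⟩ := hsub c
      rw [hc] at hm hidx
      dsimp only at hm hidx
      obtain ⟨y', hy'⟩ := exists_eq_pointed_of_length (j := j) (k := m c) hy
        (hlen.trans hm.symm)
      have hval := hchild.stateValid hst
      rw [← hm] at hval
      have hr := ih hval (fun _ => hholds.2) (ψ _) hidx (Fin.append v y')
      rw [h, pointed_append, hy', s.isPi_dual] at hr
      have hholds' : StateHolds S dom n st' (j, (pointed v).2 ++ y) := hholds
      simp only [hholds', iff_true] at hr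
      cases s.isPi <;> simp at hr
    · obtain ⟨hm, hidx⟩ := hsub c
      obtain ⟨st', hchild, hidx', hwon'⟩ :=
        (hg.succ N s.isPi n st k hst c).1 (hC ▸ c.2)
      have hval := hchild.stateValid hst
      rw [← hm] at hval
      rw [hidx', ← s.isPi_dual] at hidx
      have hr := ih hval hwon' (ψ c) hidx (Fin.append v y)
      have hno := h _ st' hchild (pointed y).2 (mem_of_mem_pointed y)
        ((length_pointed y).trans hm)
      rw [pointed_append] at hr
      have hno' : ¬ StateHolds S dom n st' (j, (pointed v).2 ++ (pointed y).2) := hno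
      rw [hr, s.isPi_dual]
      simp only [hno', iff_false]
      cases s.isPi <;> simp

theorem mainTheorem10 (S : ComputableSignature) (dom : ℕ → Set ℕ)
    [∀ i, S.lang.Structure (dom i)] (hdom : IsComputableList S dom) :
    ∃ f : ℕ × ℕ × List ℕ → ℕ, Computable f ∧
      ∀ (n i k : ℕ) (a : Fin k → dom i),
        ∃ φ : InfFormula S.lang Side.pi n k,
          IsIndex S (zeroJump n) φ (f (n, i, List.ofFn fun x => (a x : ℕ))) ∧
          ∀ (j : ℕ) (b : Fin k → dom j),
            BackForth S n (dom i) (dom j) a b ↔ φ.Realize (dom j) b := by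
  obtain ⟨g, hg, hidx⟩ := hdom.exists_stateIndex
  -- The root has N = n, the side Π and no game position; positions arise only in its descendants.
  refine ⟨fun q => g (q.1, true, q.1, (some q.2, none)), ?_, fun n i k a => ?_⟩
  · exact hg.comp (Computable.fst.pair ((Computable.const true).pair
      (Computable.fst.pair ((Computable.option_some.comp Computable.snd).pair
        (Computable.const none)))))
  · have hval : StateValid dom n n k (some (pointed a), none) := by
      refine ⟨le_rfl, ?_, by simp⟩
      rintro P hP
      obtain rfl : pointed a = P := by simpa using hP
      exact ⟨mem_of_mem_pointed a, length_pointed a⟩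
    obtain ⟨φ, hφ⟩ := hidx.exists_isIndex hval Side.pi
    refine ⟨φ, hφ, fun j b => ?_⟩
    rw [hidx.realize_iff hval (by simp) φ hφ b, ← codedBackForth_iff]
    simp [StateHolds, Side.isPi]

end Main
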